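/- Let $Z\in\mathbb{R}^{n\times q}$ be a fixed matrix and let $r\ge 1$. Let $H_1,\dots,H_{r-1}\in\mathbb{R}^{q\times q}$ be symmetric, non-zero matrices with entries in $\{0,1\}$ and pairwise disjoint supports. For $v\in\mathbb{R}^r$ put $\Psi(v)=\sum_{j<r}v_jH_j$ (so each entry of $\Psi(v)$ is either zero or one of $v_1,\dots,v_{r-1}$) and $\Sigma(v)=Z\Psi(v)Z^{\mathsf T}+v_rI_n$. Let $\mathbb{P}=\{\psi\in\mathbb{R}^r:\Psi(\psi)\text{ positive semidefinite},\ \psi_r>0\}$, and for $\psi\in\mathbb{P}$ suppose that, under $\psi$, $Y\sim\mathrm{N}(0,\Sigma(\psi))$. Let $\ell(\psi)=-\frac12\{\log|\Sigma(\psi)|+Y^{\mathsf T}\Sigma(\psi)^{-1}Y\}$ be the log-likelihood up to a constant, $S(\psi)=\nabla\ell(\psi)\in\mathbb{R}^r$ the score, $\mathcal{I}(\psi)=\mathrm{cov}_\psi\{S(\psi)\}$ the Fisher information and, when $\mathcal{I}(\psi)$ is invertible, $W^S(\psi)=\mathcal{I}(\psi)^{-1/2}S(\psi)$, with the symmetric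 square root. For $v\in\mathbb{R}^r$ let $$A(v,\psi)=\sum_{j=1}^r v_j\,\Sigma(\psi)^{-1/2}\frac{\partial\Sigma(\psi)}{\partial\psi_j}\Sigma(\psi)^{-1/2},\qquad a(v,\psi)=\frac{\|A(v,\psi)\|}{\|A(v,\psi)\|_F},$$ where $\|\cdot\|$ and $\|\cdot\|_F$ are the spectral and Frobenius norms, and $a(v,\psi)=1$ if $A(v,\psi)=0$. Fix $\psi\in\mathbb{P}$ and $\bar a\in\mathbb{R}$ with $\bar a^2<1/8$, and suppose that $a(v,\psi)\le\bar a$ for every $v\in\mathbb{R}^r$ with $\|v\|=1$. Then $\mathcal{I}(\psi)$ is positive definite, and for every $v\in\mathbb{R}^r$ with $\|v\|=1$ the distribution of $v^{\mathsf T}W^S(\psi)$ under $\psi$ has a continuous density $g(\cdot\,;v,\psi)$ with respect to Lebesgue measure, which satisfies $$|g(t;v,\psi)-\phi(t)|\le 0.14\left\{4+\frac{0.29}{(1-8\bar a^2)^2}\right\}\bar a\qquad\text{for every }t\in\mathbb{R},$$ where $\phi$ is the standard normal density. -/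

import Mathlib

open MeasureTheory ProbabilityTheory

namespace LMM

section
open scoped MatrixOrder

/-- The symmetric inverse square root `M^{-1/2}` of a positive definite matrix `M`. -/
noncomputable def invSqrt {k : ℕ} (M : Matrix (Fin k) (Fin k) ℝ) : Matrix (Fin k) (Fin k) ℝ :=
  (CFC.sqrt M)⁻¹

end

/-- The spectral norm (operator norm for the Euclidean norms). -/
noncomputable def specNorm {k : ℕ} (M : Matrix (Fin k) (Fin k) ℝ) : ℝ :=
  ‖Matrix.toEuclideanCLM (n := Fin k) (𝕜 := ℝ) M‖

/-- The Frobenius norm. -/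
noncomputable def frobNorm {k : ℕ} (M : Matrix (Fin k) (Fin k) ℝ) : ℝ :=
  Real.sqrt (∑ i, ∑ j, M i j ^ 2)

/-- The structure of a `q × q` random effects covariance matrix with `m` parameters: every entry is
either known to be zero (`none`) or equal to one of the parameters (`some j`), symmetrically, and
every parameter occurs. -/
structure CovPattern (q m : ℕ) where
  entry : Fin q → Fin q → Option (Fin m)
  symm : ∀ i k, entry i k = entry k i
  occurs : ∀ j, ∃ i k, entry i k = some j

/-- A linear mixed model `Y = Z U + E` (with known zero mean): a design matrix `Z` and the structure
of the covariance matrix of `U`. The parameter `ψ` has `r = m + 1` coordinates; the last one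
is the error variance. -/
structure Model (n q m : ℕ) where
  Z : Matrix (Fin n) (Fin q) ℝ
  pattern : CovPattern q m

namespace Model

variable {n q m : ℕ} (M : Model n q m)

/-- `H_j = ∂Ψ/∂ψ_j`, a matrix of zeros and ones, for `j < r`. -/
def H (j : Fin m) : Matrix (Fin q) (Fin q) ℝ :=
  Matrix.of fun i k => if M.pattern.entry i k = some j then 1 else 0

/-- `Ψ(v) = ∑_{j < r} v_j H_j` (and `H_r = 0`). -/
noncomputable def Psi (v : EuclideanSpace ℝ (Fin (m + 1))) : Matrix (Fin q) (Fin q) ℝ :=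
  ∑ j : Fin m, v j.castSucc • M.H j

/-- `Σ(v) = Z Ψ(v) Zᵀ + v_r I_n`. -/
noncomputable def Sigma (v : EuclideanSpace ℝ (Fin (m + 1))) : Matrix (Fin n) (Fin n) ℝ :=
  M.Z * M.Psi v * M.Z.transpose + v (Fin.last m) • (1 : Matrix (Fin n) (Fin n) ℝ)

/-- The parameter set: `Ψ(ψ)` is positive semidefinite and `ψ_r > 0`. -/
def paramSet : Set (EuclideanSpace ℝ (Fin (m + 1))) :=
  {ψ | (M.Psi ψ).PosSemidef ∧ 0 < ψ (Fin.last m)}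

/-- `∂Σ/∂ψ_j`, that is, `Z H_j Zᵀ` for `j < r` and `I_n` for `j = r`. -/
noncomputable def dSigma (j : Fin (m + 1)) : Matrix (Fin n) (Fin n) ℝ :=
  Fin.lastCases (motive := fun _ => Matrix (Fin n) (Fin n) ℝ) 1
    (fun j' : Fin m => M.Z * M.H j' * M.Z.transpose) j

theorem Sigma_eq_sum (v : EuclideanSpace ℝ (Fin (m + 1))) :
    M.Sigma v = ∑ j, v j • M.dSigma j := by
  simp [Sigma, Psi, dSigma, Fin.sum_univ_castSucc, Matrix.mul_sum, Matrix.sum_mul]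

/-- `A_j(ψ) = Σ(ψ)^{-1/2} {∂Σ(ψ)/∂ψ_j} Σ(ψ)^{-1/2}`. -/
noncomputable def Aj (j : Fin (m + 1)) (ψ : EuclideanSpace ℝ (Fin (m + 1))) :
    Matrix (Fin n) (Fin n) ℝ :=
  invSqrt (M.Sigma ψ) * M.dSigma j * invSqrt (M.Sigma ψ)

/-- `A(v, ψ) = ∑_j v_j A_j(ψ)`. -/
noncomputable def A (v ψ : EuclideanSpace ℝ (Fin (m + 1))) : Matrix (Fin n) (Fin n) ℝ :=
  ∑ j, v j • M.Aj j ψ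

theorem A_eq (v ψ : EuclideanSpace ℝ (Fin (m + 1))) :
    M.A v ψ = invSqrt (M.Sigma ψ) * M.Sigma v * invSqrt (M.Sigma ψ) := by
  simp [A, Aj, M.Sigma_eq_sum v, Matrix.mul_sum, Matrix.sum_mul]

/-- `a(v, ψ)`: the ratio of the spectral and the Frobenius norm of `A(v, ψ)`, and `1` if
`A(v, ψ) = 0`. -/
noncomputable def a (v ψ : EuclideanSpace ℝ (Fin (m + 1))) : ℝ :=
  open Classical in
  if frobNorm (M.A v ψ) = 0 then 1 else specNorm (M.A v ψ) / frobNorm (M.A v ψ)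

/-- The log-likelihood `-(log |Σ(ψ)| + yᵀ Σ(ψ)⁻¹ y) / 2` (up to an additive constant). -/
noncomputable def logLik (y : EuclideanSpace ℝ (Fin n)) (ψ : EuclideanSpace ℝ (Fin (m + 1))) : ℝ :=
  -(1 / 2) * (Real.log (M.Sigma ψ).det + y.ofLp ⬝ᵥ ((M.Sigma ψ)⁻¹.mulVec y.ofLp))

/-- The score `S(ψ)`: the gradient of the log-likelihood. -/
noncomputable def score (ψ : EuclideanSpace ℝ (Fin (m + 1))) (y : EuclideanSpace ℝ (Fin n)) :
    EuclideanSpace ℝ (Fin (m + 1)) :=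
  gradient (M.logLik y) ψ

/-- The distribution `N(0, Σ(ψ))` of `Y` under `ψ`. -/
noncomputable def law (ψ : EuclideanSpace ℝ (Fin (m + 1))) : Measure (EuclideanSpace ℝ (Fin n)) :=
  multivariateGaussian 0 (M.Sigma ψ)

/-- The Fisher information `I(ψ) = cov_ψ{S(ψ)}`. -/
noncomputable def fisherInfo (ψ : EuclideanSpace ℝ (Fin (m + 1))) :
    Matrix (Fin (m + 1)) (Fin (m + 1)) ℝ :=
  Matrix.of fun i j => cov[fun y => M.score ψ y i, fun y => M.score ψ y j; M.law ψ]

/-- The standardized score `W(ψ) = I(ψ)^{-1/2} S(ψ)`. -/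
noncomputable def W (ψ : EuclideanSpace ℝ (Fin (m + 1))) (y : EuclideanSpace ℝ (Fin n)) :
    EuclideanSpace ℝ (Fin (m + 1)) :=
  Matrix.toEuclideanCLM (n := Fin (m + 1)) (𝕜 := ℝ) (invSqrt (M.fisherInfo ψ)) (M.score ψ y)

end Model

/-- `g` is the continuous density of the distribution `μ` on the real line with respect to Lebesgue
measure; it is unique if it exists. -/
def IsContinuousDensity (μ : Measure ℝ) (g : ℝ → ℝ) : Prop :=
  Continuous g ∧ (∀ t, 0 ≤ g t) ∧ μ = volume.withDensity fun t => ENNReal.ofReal (g t)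

end LMM

/-! Write `Y = Σ^{1/2} X` with `X` standard normal. Then `vᵀW = uᵀS` for `u = I^{-1/2} v`, and this
is the centered quadratic form `(Xᵀ A X - tr A) / 2` with `A = A(u, ψ)`. In an eigenbasis of `A` it
becomes `∑ σ_j (X_j² - 1) / 2`. Standardization means `∑ σ_j² = 2`, and since `a` is scale
invariant, its bound gives `|σ_j| ≤ b = √2 ā`. The same variance formula makes the information
positive definite: `A(u, ψ) = 0` would force `a = 1 > ā`.

The characteristic function is `exp L(t)`, with `L` the function `chiSqLogCharFun`. Two estimates
carry the proof: the decay `|exp L(t)| ≤ (1 + b²t²)^(-1/(2b²))` (`norm_exp_chiSqLogCharFun_le`) and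
`|L'(t) + t| ≤ b t²` (`norm_deriv_chiSqLogCharFun_add_le`). Integrating the derivative of `exp (L(u)
+ u²/2)` compares `exp L` with `exp (-t²/2)`. By Tonelli and the Gaussian tail bound, the factor
`exp (u²/2)` cancels, leaving an explicit integral equal to `b / (1 - 2b²)` on each half-line.
Fourier inversion turns this `L¹` bound into the uniform bound `b / (π (1 - 2b²))` for the
densities, and `density_bound_le` compares it with the stated constant. -/

/-! ### Fourier inversion for measures with integrable characteristic function -/

section FourierInversion

open scoped FourierTransform SchwartzMap ContDiff
open Complex

/-- The inverse Fourier transform of the characteristic function of `μ`, rescaled to the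
normalization of `𝓕⁻`. -/
noncomputable def invCharFun (μ : Measure ℝ) : ℝ → ℂ :=
  𝓕⁻ fun v : ℝ => charFun μ (-(2 * Real.pi * v))

theorem integrable_charFun_rescale {μ : Measure ℝ} (hf : Integrable (charFun μ)) :
    Integrable fun v : ℝ => charFun μ (-(2 * Real.pi * v)) := by
  have h := hf.comp_mul_left' (R := -(2 * Real.pi)) (by simp [Real.pi_ne_zero])
  simpa only [neg_mul] using h

theorem continuous_neg_innerₗ : Continuous fun p : ℝ × ℝ => (-innerₗ ℝ) p.1 p.2 := by
  simp only [LinearMap.neg_apply, innerₗ_apply_apply]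
  exact continuous_inner.neg

theorem continuous_invCharFun {μ : Measure ℝ} (hf : Integrable (charFun μ)) :
    Continuous (invCharFun μ) :=
  VectorFourier.fourierIntegral_continuous (L := -innerₗ ℝ) Real.continuous_fourierChar
    continuous_neg_innerₗ (integrable_charFun_rescale hf)

/-- The factor `-2π` translates between the two conventions `exp (i t x)` and `exp (-2π i v x)`. -/
theorem charFun_rescale_eq_fourierIntegral (μ : Measure ℝ) (v : ℝ) :
    charFun μ (-(2 * Real.pi * v)) =
      VectorFourier.fourierIntegral Real.fourierChar μ (innerₗ ℝ).flip (fun _ => (1 : ℂ)) v := by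
  rw [charFun_eq_fourierIntegral']
  have : -(2 * Real.pi)⁻¹ • -(2 * Real.pi * v) = v := by
    simp only [smul_eq_mul]; field_simp
  rw [this]
  simp only [VectorFourier.fourierIntegral, LinearMap.flip_apply, innerₗ_apply_apply,
    real_inner_comm]
  rfl

/-- With `φ = 𝓕 (𝓕⁻ φ)`, Fubini moves `𝓕` onto `μ`; a second use of Fubini, now for Lebesgue
measure, moves `𝓕⁻` from `φ` onto the characteristic function. -/
theorem integral_schwartz_eq_integral_invCharFun {μ : Measure ℝ} [IsProbabilityMeasure μ]
    (hf : Integrable (charFun μ)) (φ : 𝓢(ℝ, ℂ)) :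
    ∫ x, φ x ∂μ = ∫ x, φ x * invCharFun μ x := by
  have h1 : ∫ x, φ x ∂μ = ∫ v, (𝓕⁻ φ) v * charFun μ (-(2 * Real.pi * v)) := by
    have := VectorFourier.integral_bilin_fourierIntegral_eq_flip (ContinuousLinearMap.mul ℂ ℂ)
      (L := innerₗ ℝ) (μ := volume) (ν := μ) (f := (𝓕⁻ φ : 𝓢(ℝ, ℂ))) (g := fun _ => (1 : ℂ))
      Real.continuous_fourierChar continuous_inner (𝓕⁻ φ).integrable (integrable_const _)
    simp only [ContinuousLinearMap.mul_apply', mul_one, ← charFun_rescale_eq_fourierIntegral]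
      at this
    rw [← this]
    refine integral_congr_ae (.of_forall fun x => ?_)
    exact (congrArg (fun ψ : 𝓢(ℝ, ℂ) => ψ x)
      (FourierTransform.fourier_fourierInv_eq (F := 𝓢(ℝ, ℂ)) φ)).symm
  rw [h1]
  have := VectorFourier.integral_bilin_fourierIntegral_eq_flip (ContinuousLinearMap.mul ℂ ℂ)
      (L := -innerₗ ℝ) (μ := volume) (ν := volume) (f := φ)
      (g := fun v => charFun μ (-(2 * Real.pi * v)))
      Real.continuous_fourierChar continuous_neg_innerₗ
      φ.integrable (integrable_charFun_rescale hf)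
  simp only [ContinuousLinearMap.mul_apply'] at this
  convert this using 1
  · refine integral_congr_ae (.of_forall fun x => ?_)
    refine congrArg (· * _) ?_
    rw [SchwartzMap.fourierInv_coe]
    simp only [Real.fourierInv_eq, VectorFourier.fourierIntegral, LinearMap.neg_apply, neg_neg,
      innerₗ_apply_apply]
  · refine integral_congr_ae (.of_forall fun x => ?_)
    simp only [invCharFun, Real.fourierInv_eq, VectorFourier.fourierIntegral, LinearMap.flip_apply,
      LinearMap.neg_apply, neg_neg, innerₗ_apply_apply, real_inner_comm]

theorem integral_contDiff_eq_integral_invCharFun {μ : Measure ℝ} [IsProbabilityMeasure μ]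
    (hf : Integrable (charFun μ)) {φ : ℝ → ℝ} (hφ : ContDiff ℝ ∞ φ) (hc : HasCompactSupport φ) :
    ∫ x, φ x ∂μ = ∫ x, φ x * (invCharFun μ x).re := by
  have h := integral_schwartz_eq_integral_invCharFun hf
    (HasCompactSupport.toSchwartzMap (f := fun x => (φ x : ℂ))
      (hc.comp_left (g := ((↑) : ℝ → ℂ)) (by simp)) (ofRealCLM.contDiff.comp hφ))
  have h2 := congrArg Complex.re h
  change (∫ x, (φ x : ℂ) ∂μ).re = (∫ x, (φ x : ℂ) * invCharFun μ x).re at h2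
  have hint : Integrable fun x => (φ x : ℂ) * invCharFun μ x := by
    apply Continuous.integrable_of_hasCompactSupport
    · exact (continuous_ofReal.comp hφ.continuous).mul (continuous_invCharFun hf)
    · exact (hc.comp_left (g := ((↑) : ℝ → ℂ)) (by simp)).mul_right
  rw [integral_complex_ofReal, ofReal_re] at h2
  rw [h2]
  have := (reCLM.integral_comp_comm hint).symm
  simp only [reCLM_apply] at this
  rw [this]
  simp

/-- A bump supported where the real part is negative would have a negative integral against it, but
a nonnegative one against `μ`. -/
theorem re_invCharFun_nonneg {μ : Measure ℝ} [IsProbabilityMeasure μ]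
    (hf : Integrable (charFun μ)) (x : ℝ) : 0 ≤ (invCharFun μ x).re := by
  by_contra! hx
  have hcont : Continuous fun x => (invCharFun μ x).re :=
    continuous_re.comp (continuous_invCharFun hf)
  obtain ⟨ε, hε, hball⟩ := Metric.isOpen_iff.1 (isOpen_Iio.preimage hcont) x hx
  let b : ContDiffBump x := ⟨ε / 2, ε, by positivity, by linarith⟩
  have h1 := integral_contDiff_eq_integral_invCharFun hf b.contDiff b.hasCompactSupport
  have h2 : 0 ≤ ∫ y, b y ∂μ := integral_nonneg fun y => b.nonneg
  have h3 : 0 < ∫ y, -(b y * (invCharFun μ y).re) := by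
    have hc : Continuous fun y => -(b y * (invCharFun μ y).re) := (b.continuous.mul hcont).neg
    refine hc.integral_pos_of_hasCompactSupport_nonneg_nonzero (x := x) ?_ ?_ ?_
    · exact b.hasCompactSupport.mul_right.comp_left (g := fun z : ℝ => -z) (by simp)
    · intro y
      by_cases hy : y ∈ Metric.ball x ε
      · have : (invCharFun μ y).re < 0 := hball hy
        have := mul_nonneg (b.nonneg (x := y)) (neg_nonneg.2 this.le)
        simpa using this
      · have : b y = 0 := b.zero_of_le_dist (by simpa using hy)
        simp [this]
    · have : b x = 1 := b.one_of_mem_closedBall (by simp [b.rIn_pos.le])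
      rw [this]; simp [hx.ne]
  rw [integral_neg] at h3
  linarith

/-- Bumps with fixed outer radius and inner radius increasing to it converge to the indicator of an
open ball, so test integrals determine the measures of open intervals. -/
theorem Measure.ext_of_integral_contDiff {μ ν : Measure ℝ} [IsLocallyFiniteMeasure μ]
    [IsLocallyFiniteMeasure ν]
    (h : ∀ φ : ℝ → ℝ, ContDiff ℝ ∞ φ → HasCompactSupport φ → ∫ x, φ x ∂μ = ∫ x, φ x ∂ν) :
    μ = ν := by
  refine Real.measure_ext_Ioo_rat fun a b => ?_
  rcases le_or_gt (b : ℝ) a with hab | hab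
  · simp [Set.Ioo_eq_empty hab.not_gt]
  set c : ℝ := (a + b) / 2 with hc
  set r : ℝ := (b - a) / 2 with hr
  have hr0 : 0 < r := by simp only [hr]; linarith
  have hball : Set.Ioo (a : ℝ) b = Metric.ball c r := by
    rw [Real.ball_eq_Ioo]; congr 1 <;> simp only [hc, hr] <;> ring
  rw [hball]
  let φ : ℕ → ContDiffBump c := fun n =>
    -- The shift by 2 keeps the inner radius positive at `n = 0`.
    ⟨r * (1 - 1 / ((n : ℝ) + 2)), r, by
      refine mul_pos hr0 ?_
      have : 1 / ((n : ℝ) + 2) < 1 := by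
        rw [div_lt_one (by positivity)]; linarith [n.cast_nonneg (α := ℝ)]
      linarith, by
      have : 0 < 1 / ((n : ℝ) + 2) := by positivity
      nlinarith⟩
  have key : ∀ (ρ : Measure ℝ) [IsLocallyFiniteMeasure ρ],
      Filter.Tendsto (fun n => ∫ x, φ n x ∂ρ) Filter.atTop (nhds (ρ.real (Metric.ball c r))) := by
    intro ρ _
    have hfin : ρ (Metric.ball c r) ≠ ⊤ := by
      rw [Real.ball_eq_Ioo]; exact measure_Ioo_lt_top.ne
    rw [← integral_indicator_one Metric.isOpen_ball.measurableSet]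
    refine tendsto_integral_of_dominated_convergence
      ((Metric.ball c r).indicator 1) (fun n => (φ n).continuous.aestronglyMeasurable) ?_ ?_ ?_
    · exact (integrable_indicator_iff Metric.isOpen_ball.measurableSet).2
        (integrableOn_const hfin)
    · refine fun n => .of_forall fun x => ?_
      rw [Real.norm_of_nonneg (φ n).nonneg]
      by_cases hx : x ∈ Metric.ball c r
      · simpa [hx] using (φ n).le_one
      · rw [(φ n).zero_of_le_dist (by simpa using hx)]; simp [hx]
    · refine .of_forall fun x => ?_
      by_cases hx : x ∈ Metric.ball c r
      · simp only [hx, Set.indicator_of_mem, Pi.one_apply]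
        refine tendsto_const_nhds.congr' ?_
        have hlim : Filter.Tendsto (fun n : ℕ => r * (1 - 1 / ((n : ℝ) + 2))) Filter.atTop
            (nhds (r * (1 - 0))) := by
          refine (tendsto_const_nhds.sub ?_).const_mul _
          exact tendsto_const_nhds.div_atTop
            (Filter.tendsto_atTop_add_const_right _ _ tendsto_natCast_atTop_atTop)
        rw [sub_zero, mul_one] at hlim
        filter_upwards [hlim.eventually (lt_mem_nhds (Metric.mem_ball.1 hx))] with n hn
        exact ((φ n).one_of_mem_closedBall (Metric.mem_closedBall.2 hn.le)).symm
      · simp only [hx, not_false_eq_true, Set.indicator_of_notMem]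
        refine tendsto_const_nhds.congr fun n => ?_
        exact ((φ n).zero_of_le_dist (by simpa using hx)).symm
  have h1 := key μ
  have h2 := key ν
  simp only [h _ (φ _).contDiff (φ _).hasCompactSupport] at h1
  have h3 := tendsto_nhds_unique h1 h2
  rwa [measureReal_eq_measureReal_iff] at h3

/-- **Inversion formula.** A probability measure on `ℝ` with integrable characteristic function has
a continuous density. -/
theorem isContinuousDensity_invCharFun {μ : Measure ℝ} [IsProbabilityMeasure μ]
    (hf : Integrable (charFun μ)) :
    LMM.IsContinuousDensity μ fun x => (invCharFun μ x).re := by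
  have hcont : Continuous fun x => (invCharFun μ x).re :=
    continuous_re.comp (continuous_invCharFun hf)
  refine ⟨hcont, re_invCharFun_nonneg hf, ?_⟩
  have : IsLocallyFiniteMeasure
      (volume.withDensity fun x => ENNReal.ofReal (invCharFun μ x).re) :=
    IsLocallyFiniteMeasure.withDensity_ofReal hcont
  refine Measure.ext_of_integral_contDiff fun φ hφ hc => ?_
  rw [integral_contDiff_eq_integral_invCharFun hf hφ hc,
    integral_withDensity_eq_integral_toReal_smul hcont.measurable.ennreal_ofReal
      (.of_forall fun _ => ENNReal.ofReal_lt_top)]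
  simp only [ENNReal.toReal_ofReal (re_invCharFun_nonneg hf _), smul_eq_mul, mul_comm]

theorem abs_re_invCharFun_sub_le {μ ν : Measure ℝ} (hμ : Integrable (charFun μ))
    (hν : Integrable (charFun ν)) (x : ℝ) :
    |(invCharFun μ x).re - (invCharFun ν x).re| ≤
      (2 * Real.pi)⁻¹ * ∫ t, ‖charFun μ t - charFun ν t‖ := by
  rw [← sub_re]
  refine (abs_re_le_norm _).trans ?_
  have hiμ := integrable_charFun_rescale hμ
  have hiν := integrable_charFun_rescale hν
  have hsub : invCharFun μ x - invCharFun ν x =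
      𝓕⁻ (fun v : ℝ => charFun μ (-(2 * Real.pi * v)) - charFun ν (-(2 * Real.pi * v))) x := by
    simp only [invCharFun, Real.fourierInv_eq, smul_sub]
    rw [integral_sub]
    · simpa using (VectorFourier.fourierIntegral_convergent_iff (L := -innerₗ ℝ)
        Real.continuous_fourierChar
        continuous_neg_innerₗ x).2 hiμ
    · simpa using (VectorFourier.fourierIntegral_convergent_iff (L := -innerₗ ℝ)
        Real.continuous_fourierChar
        continuous_neg_innerₗ x).2 hiν
  rw [hsub]
  refine (VectorFourier.norm_fourierIntegral_le_integral_norm _ _ (-innerₗ ℝ) _ _).trans ?_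
  have := Measure.integral_comp_mul_left (fun t => ‖charFun μ t - charFun ν t‖) (-(2 * Real.pi))
  simp only [neg_mul] at this
  rw [this, smul_eq_mul, abs_inv, abs_neg, abs_of_pos (by positivity)]

/-- Two densities agree almost everywhere, hence everywhere by continuity. This identifies the
normal density with its inversion integral. -/
theorem invCharFun_re_eq_of_isContinuousDensity {μ : Measure ℝ} [IsProbabilityMeasure μ]
    (hf : Integrable (charFun μ)) {g : ℝ → ℝ} (hg : LMM.IsContinuousDensity μ g) :
    (fun x => (invCharFun μ x).re) = g := by
  obtain ⟨hc, h0, h⟩ := isContinuousDensity_invCharFun hf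
  obtain ⟨hc', h0', h'⟩ := hg
  rw [h] at h'
  have hae := (withDensity_eq_iff_of_sigmaFinite hc.measurable.ennreal_ofReal.aemeasurable
    hc'.measurable.ennreal_ofReal.aemeasurable).1 h'
  refine Continuous.ae_eq_iff_eq volume hc hc' |>.1 ?_
  filter_upwards [hae] with x hx
  exact (ENNReal.ofReal_eq_ofReal_iff (h0 x) (h0' x)).1 hx

end FourierInversion

/-! ### Characteristic functions of weighted chi-squared sums -/

section WeightedChiSquared

open Complex

variable {ι : Type*} [Fintype ι]

/-- The logarithm of the characteristic function of `(1 / 2) ∑ j, σ j * (X j ^ 2 - 1)`, for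
independent standard normal variables `X j`. -/
noncomputable def chiSqLogCharFun (σ : ι → ℝ) (t : ℝ) : ℂ :=
  ∑ j, (-(1 / 2) * log (1 - σ j * t * I) - σ j * t / 2 * I)

theorem chiSqLogCharFun_neg (σ : ι → ℝ) (t : ℝ) :
    chiSqLogCharFun σ (-t) = chiSqLogCharFun (-σ) t := by
  simp [chiSqLogCharFun]

theorem one_sub_mul_I_mem_slitPlane (x : ℝ) : 1 - x * I ∈ slitPlane :=
  Or.inl (by simp)

theorem hasDerivAt_chiSqLogCharFun (σ : ι → ℝ) (t : ℝ) :
    HasDerivAt (chiSqLogCharFun σ)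
      (∑ j, (1 / 2 * (σ j * I / (1 - σ j * t * I)) - σ j / 2 * I)) t := by
  refine HasDerivAt.fun_sum fun j _ => ?_
  have h1 : HasDerivAt (fun t : ℝ => (1 : ℂ) - σ j * t * I) (-(σ j * I)) t := by
    have := (((ofRealCLM.hasDerivAt (x := t)).const_mul (σ j : ℂ)).mul_const I).const_sub 1
    simpa using this
  have h2 : HasDerivAt (fun t : ℝ => (σ j : ℂ) * t / 2 * I) (σ j / 2 * I) t := by
    have := (((ofRealCLM.hasDerivAt (x := t)).const_mul (σ j : ℂ)).div_const 2).mul_const I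
    simpa using this
  have hs : (1 : ℂ) - σ j * t * I ∈ slitPlane := by
    simpa using one_sub_mul_I_mem_slitPlane (σ j * t)
  have h3 := ((h1.clog_real hs).const_mul (-(1 / 2) : ℂ)).sub h2
  refine h3.congr_deriv ?_
  ring

theorem continuous_chiSqLogCharFun (σ : ι → ℝ) : Continuous (chiSqLogCharFun σ) :=
  continuous_iff_continuousAt.2 fun t => (hasDerivAt_chiSqLogCharFun σ t).continuousAt

theorem chiSqLogCharFun_re (σ : ι → ℝ) (t : ℝ) :
    (chiSqLogCharFun σ t).re = -(1 / 4) * ∑ j, Real.log (1 + σ j ^ 2 * t ^ 2) := by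
  rw [chiSqLogCharFun, re_sum, Finset.mul_sum]
  refine Finset.sum_congr rfl fun j _ => ?_
  have h : ‖(1 : ℂ) - σ j * t * I‖ = Real.sqrt (1 + σ j ^ 2 * t ^ 2) := by
    rw [norm_def, normSq_apply]
    simp
    ring_nf
  have h2 : (-(1 / 2) * log (1 - σ j * t * I) - σ j * t / 2 * I).re =
      -(1 / 2) * (log (1 - σ j * t * I)).re := by
    simp [← ofReal_mul]
  rw [h2, log_re, h, Real.log_sqrt (by positivity)]
  ring

/-- The modulus is the product of the factors `(1 + σ_j²t²)^(-1/4)`. Bernoulli's inequality with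
exponent `σ_j²/b² ≤ 1` compares each with a power of `1 + b²t²`, and these exponents sum to `2/b²`.
-/
theorem norm_exp_chiSqLogCharFun_le {σ : ι → ℝ} {b : ℝ} (hb : 0 < b) (hσ : ∑ j, σ j ^ 2 = 2)
    (hσb : ∀ j, |σ j| ≤ b) (t : ℝ) :
    ‖exp (chiSqLogCharFun σ t)‖ ≤ (1 + b ^ 2 * t ^ 2) ^ (-(2 * b ^ 2)⁻¹) := by
  rw [norm_exp, chiSqLogCharFun_re, Real.rpow_def_of_pos (by positivity)]
  refine Real.exp_le_exp.2 ?_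
  have key : ∀ j, σ j ^ 2 / b ^ 2 * Real.log (1 + b ^ 2 * t ^ 2) ≤
      Real.log (1 + σ j ^ 2 * t ^ 2) := by
    intro j
    have hw : σ j ^ 2 / b ^ 2 ≤ 1 := by
      rw [div_le_one (by positivity)]
      exact sq_le_sq.2 ((hσb j).trans (le_abs_self b))
    rw [← Real.log_rpow (by positivity)]
    refine Real.log_le_log (by positivity) ?_
    refine (rpow_one_add_le_one_add_mul_self (by nlinarith [mul_nonneg (sq_nonneg b) (sq_nonneg t)])
      (by positivity) hw).trans_eq ?_
    field_simp
  have hsum := Finset.sum_le_sum fun j (_ : j ∈ Finset.univ) => key j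
  rw [← Finset.sum_mul, ← Finset.sum_div, hσ] at hsum
  have : Real.log (1 + b ^ 2 * t ^ 2) * -(2 * b ^ 2)⁻¹ =
      -(1 / 4) * (2 / b ^ 2 * Real.log (1 + b ^ 2 * t ^ 2)) := by field_simp; norm_num
  rw [this]
  linarith

theorem integrable_exp_chiSqLogCharFun {σ : ι → ℝ} {b : ℝ} (hb : 0 < b) (hb2 : b ^ 2 < 1 / 4)
    (hσ : ∑ j, σ j ^ 2 = 2) (hσb : ∀ j, |σ j| ≤ b) :
    Integrable fun t => exp (chiSqLogCharFun σ t) := by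
  have hint : Integrable fun t : ℝ => (1 + (b * t) ^ 2)⁻¹ :=
    integrable_inv_one_add_sq.comp_mul_left' hb.ne'
  refine hint.mono' (continuous_exp.comp (continuous_chiSqLogCharFun σ)).aestronglyMeasurable
    (.of_forall fun t => (norm_exp_chiSqLogCharFun_le hb hσ hσb t).trans ?_)
  rw [mul_pow, ← Real.rpow_neg_one (1 + b ^ 2 * t ^ 2)]
  refine Real.rpow_le_rpow_of_exponent_le (by nlinarith [mul_nonneg (sq_nonneg b) (sq_nonneg t)]) ?_
  rw [neg_le_neg_iff, one_le_inv₀ (by positivity)]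
  linarith

/-- Since `t = ∑ σ_j² t / 2`, adding `t` cancels the linear term of `L'`. Each remainder is at most
`|σ_j|³ t² / 2` because `|1 - i σ_j t| ≥ 1`; one factor `|σ_j|` is bounded by `b`. -/
theorem norm_deriv_chiSqLogCharFun_add_le {σ : ι → ℝ} {b : ℝ} (hσ : ∑ j, σ j ^ 2 = 2)
    (hσb : ∀ j, |σ j| ≤ b) (t : ℝ) :
    ‖(∑ j, (1 / 2 * (σ j * I / (1 - σ j * t * I)) - σ j / 2 * I)) + t‖ ≤ b * t ^ 2 := by
  have h1 : (∑ j, (1 / 2 * (σ j * I / (1 - σ j * t * I)) - σ j / 2 * I)) + (t : ℂ) =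
      ∑ j, -((σ j : ℂ) ^ 3 * t ^ 2 / 2 * I) / (1 - σ j * t * I) := by
    have : (t : ℂ) = ∑ j, (σ j : ℂ) ^ 2 * t / 2 := by
      rw [← Finset.sum_div, ← Finset.sum_mul]
      have : ∑ j, (σ j : ℂ) ^ 2 = 2 := mod_cast hσ
      rw [this]; ring
    refine (congrArg (_ + ·) this).trans ?_
    rw [← Finset.sum_add_distrib]
    refine Finset.sum_congr rfl fun j _ => ?_
    have hne : (1 : ℂ) - σ j * t * I ≠ 0 := by
      simpa using slitPlane_ne_zero (one_sub_mul_I_mem_slitPlane (σ j * t))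
    rw [mul_right_comm] at hne
    field_simp
    linear_combination (σ j : ℂ) ^ 2 * t * I_sq
  rw [h1]
  have h2 : ∀ j, ‖-((σ j : ℂ) ^ 3 * t ^ 2 / 2 * I) / (1 - σ j * t * I)‖ ≤
      σ j ^ 2 * (b * t ^ 2 / 2) := by
    intro j
    have hd : 1 ≤ ‖(1 : ℂ) - σ j * t * I‖ := by
      refine le_trans ?_ (abs_re_le_norm _)
      simp
    rw [norm_div]
    refine (div_le_self (norm_nonneg _) hd).trans ?_
    have : ‖-((σ j : ℂ) ^ 3 * t ^ 2 / 2 * I)‖ = |σ j| * σ j ^ 2 * t ^ 2 / 2 := by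
      simp only [norm_neg, norm_mul, norm_div, norm_pow, norm_real, Real.norm_eq_abs, norm_I,
        mul_one, sq_abs]
      rw [pow_succ, sq_abs, Complex.norm_ofNat]; ring
    rw [this]
    have := mul_le_mul_of_nonneg_right (hσb j) (mul_nonneg (sq_nonneg (σ j)) (sq_nonneg t))
    nlinarith
  refine (norm_sum_le _ _).trans ((Finset.sum_le_sum fun j _ => h2 j).trans_eq ?_)
  rw [← Finset.sum_mul, hσ]
  ring

/-- The function `exp (L(u) + u²/2)` equals 1 at 0 and would be constant in the exactly normal case;
the integral of its derivative measures the deviation. -/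
theorem norm_exp_chiSqLogCharFun_sub_le {σ : ι → ℝ} {b : ℝ} (hb : 0 < b)
    (hσ : ∑ j, σ j ^ 2 = 2) (hσb : ∀ j, |σ j| ≤ b) {t : ℝ} (ht : 0 ≤ t) :
    ‖exp (chiSqLogCharFun σ t) - exp (-t ^ 2 / 2)‖ ≤
      Real.exp (-t ^ 2 / 2) * ∫ u in (0 : ℝ)..t,
        b * u ^ 2 * (1 + b ^ 2 * u ^ 2) ^ (-(2 * b ^ 2)⁻¹) * Real.exp (u ^ 2 / 2) := by
  set L' : ℝ → ℂ := fun u => ∑ j, (1 / 2 * (σ j * I / (1 - σ j * u * I)) - σ j / 2 * I) with hL'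
  have hcontL' : Continuous L' := by
    refine continuous_finsetSum _ fun j _ => ?_
    refine (continuous_const.mul (continuous_const.div (by fun_prop) fun u => ?_)).sub
      continuous_const
    simpa using slitPlane_ne_zero (one_sub_mul_I_mem_slitPlane (σ j * u))
  have hderiv : ∀ u : ℝ, HasDerivAt (fun u : ℝ => exp (chiSqLogCharFun σ u + (u : ℂ) ^ 2 / 2))
      (exp (chiSqLogCharFun σ u + (u : ℂ) ^ 2 / 2) * (L' u + u)) u := by
    intro u
    refine HasDerivAt.cexp ((hasDerivAt_chiSqLogCharFun σ u).add ?_)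
    have := ((ofRealCLM.hasDerivAt (x := u)).pow 2).div_const 2
    simpa using this
  have hcont : Continuous fun u : ℝ =>
      exp (chiSqLogCharFun σ u + (u : ℂ) ^ 2 / 2) * (L' u + u) := by
    have := continuous_chiSqLogCharFun σ
    fun_prop
  have hFTC := intervalIntegral.integral_eq_sub_of_hasDerivAt (a := 0) (b := t)
    (fun u _ => hderiv u) (hcont.intervalIntegrable _ _)
  have h0 : chiSqLogCharFun σ 0 = 0 := by simp [chiSqLogCharFun]
  simp only [h0, ofReal_zero, ne_eq, OfNat.ofNat_ne_zero, not_false_eq_true, zero_pow, zero_div,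
    add_zero, exp_zero] at hFTC
  have hfac : exp (chiSqLogCharFun σ t) - exp (-t ^ 2 / 2) =
      exp (-t ^ 2 / 2) * (exp (chiSqLogCharFun σ t + (t : ℂ) ^ 2 / 2) - 1) := by
    rw [mul_sub, ← exp_add, mul_one]; congr 2; ring
  have hreal : (-t ^ 2 / 2 : ℂ) = ((-t ^ 2 / 2 : ℝ) : ℂ) := by push_cast; ring
  rw [hfac, norm_mul, hreal, norm_exp_ofReal, ← hFTC]
  refine mul_le_mul_of_nonneg_left ?_ (Real.exp_pos _).le
  refine intervalIntegral.norm_integral_le_of_norm_le ht (.of_forall fun u _ => ?_) ?_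
  · have hreal' : ((u : ℂ) ^ 2 / 2) = ((u ^ 2 / 2 : ℝ) : ℂ) := by push_cast; ring
    rw [norm_mul, exp_add, norm_mul, hreal', norm_exp_ofReal]
    have h1 := norm_exp_chiSqLogCharFun_le hb hσ hσb u
    have h2 := norm_deriv_chiSqLogCharFun_add_le hσ hσb u
    calc _ ≤ (1 + b ^ 2 * u ^ 2) ^ (-(2 * b ^ 2)⁻¹) * Real.exp (u ^ 2 / 2) * (b * u ^ 2) := by
          gcongr
      _ = _ := by ring
  · refine Continuous.intervalIntegrable ?_ _ _
    refine ((by fun_prop : Continuous fun u : ℝ => b * u ^ 2).mul ?_).mul (by fun_prop)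
    exact (by fun_prop : Continuous fun u : ℝ => 1 + b ^ 2 * u ^ 2).rpow_const
      fun u => Or.inl (by positivity)

/-- Inserting the factor `t / u ≥ 1` makes the integrand an exact derivative. -/
theorem lintegral_Ioi_exp_neg_sq_le {u : ℝ} (hu : 0 < u) :
    ∫⁻ t in Set.Ioi u, ENNReal.ofReal (Real.exp (-t ^ 2 / 2)) ≤
      ENNReal.ofReal (Real.exp (-u ^ 2 / 2) / u) := by
  have hderiv : ∀ t : ℝ, HasDerivAt (fun t => -Real.exp (-t ^ 2 / 2) / u)
      (t / u * Real.exp (-t ^ 2 / 2)) t := by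
    intro t
    have h := (((((hasDerivAt_id t).pow 2).neg).div_const 2).exp.neg).div_const u
    refine h.congr_deriv ?_
    simp; ring
  have hlim : Filter.Tendsto (fun t : ℝ => -Real.exp (-t ^ 2 / 2) / u) Filter.atTop (nhds 0) := by
    have : Filter.Tendsto (fun t : ℝ => t ^ 2 / 2) Filter.atTop Filter.atTop :=
      (Filter.tendsto_pow_atTop two_ne_zero).atTop_div_const two_pos
    have := ((Real.tendsto_exp_neg_atTop_nhds_zero.comp this).neg).div_const u
    simpa [Function.comp_def, neg_div] using this
  have hnn : ∀ t ∈ Set.Ioi u, 0 ≤ t / u * Real.exp (-t ^ 2 / 2) := fun t ht => by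
    have : 0 < t := hu.trans ht
    positivity
  have hint := integrableOn_Ioi_deriv_of_nonneg' (a := u) (fun t _ => hderiv t) hnn hlim
  have hval := integral_Ioi_of_hasDerivAt_of_nonneg' (a := u) (fun t _ => hderiv t) hnn hlim
  have : Real.exp (-u ^ 2 / 2) / u = ∫ t in Set.Ioi u, t / u * Real.exp (-t ^ 2 / 2) := by
    rw [hval]; ring
  rw [this, ofReal_integral_eq_lintegral_ofReal hint
    ((ae_restrict_iff' measurableSet_Ioi).2 (.of_forall hnn))]
  refine setLIntegral_mono' measurableSet_Ioi fun t ht => ENNReal.ofReal_le_ofReal ?_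
  have : 1 ≤ t / u := by rw [one_le_div hu]; exact (Set.mem_Ioi.1 ht).le
  nlinarith [Real.exp_pos (-t ^ 2 / 2)]

theorem lintegral_Ioi_mul_rpow {b : ℝ} (hb : 0 < b) (hb2 : b ^ 2 < 1 / 4) :
    ∫⁻ u in Set.Ioi (0 : ℝ), ENNReal.ofReal (b * u * (1 + b ^ 2 * u ^ 2) ^ (-(2 * b ^ 2)⁻¹)) =
      ENNReal.ofReal (b / (1 - 2 * b ^ 2)) := by
  set p : ℝ := (2 * b ^ 2)⁻¹ with hp
  have hp1 : 1 < p := by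
    rw [hp, one_lt_inv₀ (by positivity)]; linarith
  -- The constant comes from `2b² (p - 1) = 1 - 2b²`; the antiderivative vanishes at infinity
  -- because `p > 1`.
  have hderiv : ∀ u : ℝ, HasDerivAt
      (fun u => -(b / (1 - 2 * b ^ 2)) * (1 + b ^ 2 * u ^ 2) ^ (1 - p))
      (b * u * (1 + b ^ 2 * u ^ 2) ^ (-p)) u := by
    intro u
    have hpos : 0 < 1 + b ^ 2 * u ^ 2 := by positivity
    have h1 : HasDerivAt (fun u : ℝ => 1 + b ^ 2 * u ^ 2) (b ^ 2 * (2 * u)) u := by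
      simpa using (((hasDerivAt_id u).pow 2).const_mul (b ^ 2)).const_add 1
    refine ((h1.rpow_const (p := 1 - p) (Or.inl hpos.ne')).const_mul
      (-(b / (1 - 2 * b ^ 2)))).congr_deriv ?_
    rw [show 1 - p - 1 = -p by ring]
    have hne : 1 - 2 * b ^ 2 ≠ 0 := by linarith
    have : 1 - p = -(1 - 2 * b ^ 2) * p := by
      rw [hp]; field_simp; ring
    rw [this, hp]
    field_simp
    rw [mul_comm 2 (b ^ 2)] at hne
    field_simp
  have hlim : Filter.Tendsto (fun u : ℝ => -(b / (1 - 2 * b ^ 2)) * (1 + b ^ 2 * u ^ 2) ^ (1 - p))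
      Filter.atTop (nhds 0) := by
    have h1 : Filter.Tendsto (fun u : ℝ => 1 + b ^ 2 * u ^ 2) Filter.atTop Filter.atTop :=
      Filter.tendsto_atTop_add_const_left _ _
        ((Filter.tendsto_pow_atTop two_ne_zero).const_mul_atTop (by positivity))
    have h2 := ((tendsto_rpow_neg_atTop (y := p - 1) (by linarith)).comp h1).const_mul
      (-(b / (1 - 2 * b ^ 2)))
    simpa [Function.comp_def] using h2
  have hnn : ∀ u ∈ Set.Ioi (0 : ℝ), 0 ≤ b * u * (1 + b ^ 2 * u ^ 2) ^ (-p) := fun u hu => by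
    have : 0 < u := hu
    positivity
  have hint := integrableOn_Ioi_deriv_of_nonneg' (a := 0) (fun t _ => hderiv t) hnn hlim
  have hval := integral_Ioi_of_hasDerivAt_of_nonneg' (a := 0) (fun t _ => hderiv t) hnn hlim
  rw [← ofReal_integral_eq_lintegral_ofReal hint
    ((ae_restrict_iff' measurableSet_Ioi).2 (.of_forall hnn)), hval]
  simp

/-- Tonelli on `0 < u < t`: the inner tail integral is at most `exp (-u²/2) / u`, which cancels both
the factor `u` and the growing exponential. -/
theorem lintegral_Ioi_exp_neg_mul_integral_le {k : ℝ → ℝ} (hk : Continuous k)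
    (hk0 : ∀ u, 0 ≤ k u) :
    ∫⁻ t in Set.Ioi (0 : ℝ), ENNReal.ofReal (Real.exp (-t ^ 2 / 2) * ∫ u in (0 : ℝ)..t,
        u * k u * Real.exp (u ^ 2 / 2)) ≤
      ∫⁻ u in Set.Ioi (0 : ℝ), ENNReal.ofReal (k u) := by
  let w : ℝ → ℝ → ENNReal := fun t u => (Set.Ioi u).indicator
    (fun t => ENNReal.ofReal (Real.exp (-t ^ 2 / 2))) t *
      ENNReal.ofReal (u * k u * Real.exp (u ^ 2 / 2))
  have hw : Measurable (Function.uncurry w) := by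
    have h1 : Measurable fun z : ℝ × ℝ => {z : ℝ × ℝ | z.2 < z.1}.indicator
        (fun z => ENNReal.ofReal (Real.exp (-z.1 ^ 2 / 2))) z :=
      Measurable.indicator (by fun_prop) (measurableSet_lt measurable_snd measurable_fst)
    have h2 : Measurable fun z : ℝ × ℝ =>
        ENNReal.ofReal (z.2 * k z.2 * Real.exp (z.2 ^ 2 / 2)) := by fun_prop
    exact h1.mul h2
  calc _ = ∫⁻ t in Set.Ioi (0 : ℝ), ∫⁻ u in Set.Ioi (0 : ℝ), w t u := by
        refine setLIntegral_congr_fun measurableSet_Ioi fun t (ht : 0 < t) => ?_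
        have hkc : Continuous fun u => u * k u * Real.exp (u ^ 2 / 2) := by fun_prop
        change ENNReal.ofReal _ = _
        rw [ENNReal.ofReal_mul (Real.exp_pos _).le, intervalIntegral.integral_of_le ht.le,
          integral_Ioc_eq_integral_Ioo, ofReal_integral_eq_lintegral_ofReal]
        · rw [← lintegral_const_mul _ hkc.measurable.ennreal_ofReal,
            ← lintegral_indicator measurableSet_Ioo, ← lintegral_indicator measurableSet_Ioi]
          refine lintegral_congr fun u => ?_
          by_cases h1 : 0 < u <;> by_cases h2 : u < t <;> simp [w, Set.indicator, h1, h2]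
        · exact (hkc.integrableOn_Icc (a := 0) (b := t)).mono_set Set.Ioo_subset_Icc_self
        · refine (ae_restrict_iff' measurableSet_Ioo).2 (.of_forall fun u hu => ?_)
          exact mul_nonneg (mul_nonneg hu.1.le (hk0 u)) (Real.exp_pos _).le
    _ = ∫⁻ u in Set.Ioi (0 : ℝ), ∫⁻ t in Set.Ioi (0 : ℝ), w t u :=
        lintegral_lintegral_swap hw.aemeasurable
    _ ≤ _ := by
        refine setLIntegral_mono' measurableSet_Ioi fun u (hu : 0 < u) => ?_
        simp only [w]
        rw [lintegral_mul_const _ (Measurable.indicator (by fun_prop) measurableSet_Ioi),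
          lintegral_indicator measurableSet_Ioi]
        have hle : (volume.restrict (Set.Ioi (0 : ℝ))).restrict (Set.Ioi u) ≤
            volume.restrict (Set.Ioi u) :=
          Measure.restrict_mono le_rfl Measure.restrict_le_self
        refine (mul_le_mul_left ((lintegral_mono' hle le_rfl).trans
          (lintegral_Ioi_exp_neg_sq_le hu)) _).trans ?_
        rw [← ENNReal.ofReal_mul (by positivity)]
        refine ENNReal.ofReal_le_ofReal (le_of_eq ?_)
        have : Real.exp (-u ^ 2 / 2) * Real.exp (u ^ 2 / 2) = 1 := by
          rw [← Real.exp_add]; ring_nf; simp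
        calc _ = k u * (Real.exp (-u ^ 2 / 2) * Real.exp (u ^ 2 / 2)) * (u / u) := by ring
          _ = k u := by rw [this, div_self hu.ne', mul_one, mul_one]

theorem lintegral_Ioi_norm_exp_chiSqLogCharFun_sub_le {σ : ι → ℝ} {b : ℝ} (hb : 0 < b)
    (hb2 : b ^ 2 < 1 / 4) (hσ : ∑ j, σ j ^ 2 = 2) (hσb : ∀ j, |σ j| ≤ b) :
    ∫⁻ t in Set.Ioi (0 : ℝ), ENNReal.ofReal ‖exp (chiSqLogCharFun σ t) - exp (-t ^ 2 / 2)‖ ≤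
      ENNReal.ofReal (b / (1 - 2 * b ^ 2)) := by
  have hk : Continuous fun u : ℝ => b * u * (1 + b ^ 2 * u ^ 2) ^ (-(2 * b ^ 2)⁻¹) :=
    (by fun_prop : Continuous fun u : ℝ => b * u).mul
      ((by fun_prop : Continuous fun u : ℝ => 1 + b ^ 2 * u ^ 2).rpow_const
        fun u => Or.inl (by positivity))
  -- The absolute value makes the kernel nonnegative on the whole line and changes nothing for `u >
  -- 0`.
  have hk' : Continuous fun u : ℝ => b * |u| * (1 + b ^ 2 * u ^ 2) ^ (-(2 * b ^ 2)⁻¹) := by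
    refine hk.abs.congr fun u => ?_
    rw [abs_mul, abs_mul, abs_of_pos hb, abs_of_nonneg (by positivity :
      0 ≤ (1 + b ^ 2 * u ^ 2) ^ (-(2 * b ^ 2)⁻¹))]
  have h := lintegral_Ioi_exp_neg_mul_integral_le (k := fun u => b * |u| *
    (1 + b ^ 2 * u ^ 2) ^ (-(2 * b ^ 2)⁻¹)) hk' (fun u => by positivity)
  rw [← lintegral_Ioi_mul_rpow hb hb2]
  refine le_trans (setLIntegral_mono' measurableSet_Ioi fun t (ht : 0 < t) => ?_) (h.trans_eq ?_)
  · refine ENNReal.ofReal_le_ofReal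
      ((norm_exp_chiSqLogCharFun_sub_le hb hσ hσb ht.le).trans_eq ?_)
    congr 1
    refine intervalIntegral.integral_congr fun u hu => ?_
    rw [Set.uIcc_of_le ht.le] at hu
    simp only [abs_of_nonneg hu.1]
    ring
  · exact setLIntegral_congr_fun measurableSet_Ioi fun u (hu : 0 < u) => by
      simp only [abs_of_pos hu]

theorem integral_norm_exp_chiSqLogCharFun_sub_le {σ : ι → ℝ} {b : ℝ} (hb : 0 < b)
    (hb2 : b ^ 2 < 1 / 4) (hσ : ∑ j, σ j ^ 2 = 2) (hσb : ∀ j, |σ j| ≤ b) :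
    ∫ t : ℝ, ‖exp (chiSqLogCharFun σ t) - exp (-t ^ 2 / 2)‖ ≤ 2 * (b / (1 - 2 * b ^ 2)) := by
  have hpos : 0 ≤ b / (1 - 2 * b ^ 2) := div_nonneg hb.le (by linarith)
  have hcont (τ : ι → ℝ) : Continuous fun t : ℝ => exp (chiSqLogCharFun τ t) - exp (-t ^ 2 / 2) := by
    have := continuous_chiSqLogCharFun τ
    fun_prop
  have hhalf {τ : ι → ℝ} (hτ : ∑ j, τ j ^ 2 = 2) (hτb : ∀ j, |τ j| ≤ b) :
      IntegrableOn (fun t : ℝ => ‖exp (chiSqLogCharFun τ t) - exp (-t ^ 2 / 2)‖) (Set.Ioi 0) ∧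
      ∫ t in Set.Ioi (0 : ℝ), ‖exp (chiSqLogCharFun τ t) - exp (-t ^ 2 / 2)‖ ≤
        b / (1 - 2 * b ^ 2) := by
    have h := lintegral_Ioi_norm_exp_chiSqLogCharFun_sub_le hb hb2 hτ hτb
    refine ⟨⟨(hcont τ).norm.aestronglyMeasurable, ?_⟩, ?_⟩
    · rw [hasFiniteIntegral_iff_ofReal (.of_forall fun _ => norm_nonneg _)]
      exact h.trans_lt ENNReal.ofReal_lt_top
    · rw [integral_eq_lintegral_of_nonneg_ae (.of_forall fun _ => norm_nonneg _)
        (hcont τ).norm.aestronglyMeasurable]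
      exact ENNReal.toReal_le_of_le_ofReal hpos h
  obtain ⟨hi, hle⟩ := hhalf hσ hσb
  -- The negative half-line is the positive one for `-σ`, which satisfies the same hypotheses.
  obtain ⟨hi', hle'⟩ := hhalf (τ := -σ) (by simpa using hσ) (by simpa using hσb)
  have hneg : (fun t : ℝ => ‖exp (chiSqLogCharFun (-σ) t) - exp (-t ^ 2 / 2)‖) =
      fun t : ℝ => ‖exp (chiSqLogCharFun σ (-t)) - exp (-(-t : ℝ) ^ 2 / 2)‖ := by
    ext t; rw [chiSqLogCharFun_neg]; simp
  rw [hneg] at hi' hle'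
  have hi'' : IntegrableOn (fun t : ℝ => ‖exp (chiSqLogCharFun σ t) - exp (-t ^ 2 / 2)‖)
      (Set.Iic 0) := by
    have := ((integrableOn_Ici_iff_integrableOn_Ioi (by simp)).2 hi').comp_neg
    simpa using this
  rw [integral_comp_neg_Ioi (f := fun t : ℝ => ‖exp (chiSqLogCharFun σ t) - exp (-t ^ 2 / 2)‖),
    neg_zero] at hle'
  rw [← intervalIntegral.integral_Iic_add_Ioi hi'' hi]
  linarith

end WeightedChiSquared

/-! ### Moments and transforms of the square of a standard normal variable -/

section GaussianMoments

open Complex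

/-- A Gaussian integral with complex parameter `z / 2`, where `z = 1 - i s`. Since `Re z = 1`, the
principal logarithm gives the correct square root. -/
theorem integral_cexp_sq_sub_one_gaussianReal (s : ℝ) :
    ∫ x, exp ((s / 2 * (x ^ 2 - 1) : ℝ) * I) ∂gaussianReal 0 1 =
      exp (-(1 / 2) * log (1 - s * I) - s / 2 * I) := by
  rw [integral_gaussianReal_eq_integral_smul one_ne_zero]
  set z : ℂ := 1 - s * I with hz
  have hzs : z ∈ slitPlane := one_sub_mul_I_mem_slitPlane s
  have hz0 : z ≠ 0 := slitPlane_ne_zero hzs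
  have h1 : ∀ x : ℝ, gaussianPDFReal 0 1 x • exp ((s / 2 * (x ^ 2 - 1) : ℝ) * I) =
      ((Real.sqrt (2 * Real.pi))⁻¹ : ℝ) * exp (-(s / 2 * I)) * exp (-(z / 2) * x ^ 2) := by
    intro x
    rw [gaussianPDFReal_def]
    simp only [NNReal.coe_one, mul_one, sub_zero, real_smul, ofReal_mul, ofReal_exp]
    rw [mul_assoc _ (exp _) (exp _), mul_assoc _ (exp _) (exp _), ← exp_add, ← exp_add]
    congr 2
    rw [hz]; push_cast; ring
  simp_rw [h1]
  have hre : 0 < (z / 2).re := by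
    simp [hz]
  rw [integral_const_mul, integral_gaussian_complex hre]
  have h2 : (Real.pi : ℂ) / (z / 2) = (2 * Real.pi : ℝ) * z⁻¹ := by
    push_cast; field_simp
  have h3 : ((Real.pi : ℂ) / (z / 2)) ^ (1 / 2 : ℂ) =
      (Real.sqrt (2 * Real.pi) : ℝ) * exp (-(1 / 2) * log z) := by
    have hpi : (0 : ℝ) < 2 * Real.pi := by positivity
    rw [h2, cpow_def_of_ne_zero (mul_ne_zero (ofReal_ne_zero.2 hpi.ne') (inv_ne_zero hz0)),
      log_ofReal_mul hpi (inv_ne_zero hz0), log_inv _ (slitPlane_arg_ne_pi hzs), add_mul, exp_add,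
      Real.sqrt_eq_rpow, Real.rpow_def_of_pos hpi]
    push_cast
    congr 2
    ring
  rw [h3, sub_eq_add_neg, exp_add]
  have hs : (Real.sqrt (2 * Real.pi) : ℂ) ≠ 0 := ofReal_ne_zero.2 (by positivity)
  push_cast
  field_simp

theorem iteratedDeriv_four_exp_half_sq :
    iteratedDeriv 4 (fun t : ℝ => Real.exp (t ^ 2 / 2)) 0 = 3 := by
  have hE : ∀ t : ℝ, HasDerivAt (fun t : ℝ => Real.exp (t ^ 2 / 2)) (Real.exp (t ^ 2 / 2) * t) t := by
    intro t
    refine (((hasDerivAt_id t).pow 2).div_const 2).exp.congr_deriv ?_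
    simp
  -- Differentiation acts on the polynomial factor by `p ↦ p' + t p`.
  have step : ∀ p p' : ℝ → ℝ, (∀ t, HasDerivAt p (p' t) t) →
      deriv (fun t : ℝ => p t * Real.exp (t ^ 2 / 2)) =
        fun t => (p' t + t * p t) * Real.exp (t ^ 2 / 2) := by
    intro p p' hp
    ext t
    rw [((hp t).fun_mul (hE t)).deriv]
    ring
  have h1 : deriv (fun t : ℝ => Real.exp (t ^ 2 / 2)) = fun t => t * Real.exp (t ^ 2 / 2) := by
    ext t; rw [(hE t).deriv]; ring
  have h2 := step (fun t => t) (fun _ => 1) (fun t => hasDerivAt_id t)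
  have h3 := step (fun t => 1 + t * t) (fun t => 2 * t) fun t =>
    (((hasDerivAt_id t).mul (hasDerivAt_id t)).const_add 1).congr_deriv (by simp; ring)
  have h4 := step (fun t => 2 * t + t * (1 + t * t)) (fun t => 3 + 3 * t ^ 2) fun t => by
    have h := hasDerivAt_id t
    refine ((h.const_mul 2).add (h.mul ((h.mul h).const_add 1))).congr_deriv ?_
    simp; ring
  rw [iteratedDeriv_succ, iteratedDeriv_succ, iteratedDeriv_succ, iteratedDeriv_one, h1, h2, h3, h4]
  simp

theorem integral_pow_four_gaussianReal : ∫ x, x ^ 4 ∂gaussianReal 0 1 = 3 := by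
  have h : iteratedDeriv 4 (mgf (fun x => x) (gaussianReal 0 1)) 0 =
      ∫ x, x ^ 4 ∂gaussianReal 0 1 := by
    rw [iteratedDeriv_mgf_zero] <;> simp
  rw [← h, mgf_fun_id_gaussianReal]
  simpa using iteratedDeriv_four_exp_half_sq

theorem memLp_sq_gaussianReal : MemLp (fun x : ℝ => x ^ 2) 2 (gaussianReal 0 1) := by
  rw [memLp_two_iff_integrable_sq (by fun_prop)]
  have := (memLp_id_gaussianReal (μ := 0) (v := 1) 4).integrable_norm_pow (by norm_num)
  refine this.congr (.of_forall fun x => ?_)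
  simp only [id, Real.norm_eq_abs]
  rw [← pow_mul, (by decide : Even 4).pow_abs]

theorem variance_sq_gaussianReal : Var[fun x : ℝ => x ^ 2; gaussianReal 0 1] = 2 := by
  rw [variance_eq_sub memLp_sq_gaussianReal]
  have h2 : ∫ x, x ^ 2 ∂gaussianReal 0 1 = 1 := by
    have h := variance_fun_id_gaussianReal (μ := 0) (v := 1)
    rw [variance_of_integral_eq_zero (by fun_prop) (by simp)] at h
    simpa using h
  have h4 : ∫ x, ((fun x : ℝ => x ^ 2) ^ 2) x ∂gaussianReal 0 1 = 3 := by
    rw [← integral_pow_four_gaussianReal]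
    refine integral_congr_ae (.of_forall fun x => ?_)
    simp only [Pi.pow_apply]; ring
  rw [h4, h2]; norm_num

end GaussianMoments

/-! ### Diagonalization of Gaussian quadratic forms -/

section QuadraticForm

variable {ι : Type*} [Fintype ι]

theorem memLp_weighted_chiSq (σ : ι → ℝ) :
    MemLp (fun x : ι → ℝ => ∑ i, σ i / 2 * (x i ^ 2 - 1)) 2
      (Measure.pi fun _ => gaussianReal 0 1) := by
  refine memLp_finsetSum _ fun i _ => MemLp.const_mul (MemLp.sub ?_ (memLp_const _)) _
  exact memLp_sq_gaussianReal.comp_measurePreserving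
    (measurePreserving_eval (fun _ : ι => gaussianReal 0 1) i)

theorem variance_weighted_chiSq (σ : ι → ℝ) :
    Var[fun x : ι → ℝ => ∑ i, σ i / 2 * (x i ^ 2 - 1); Measure.pi fun _ => gaussianReal 0 1] =
      1 / 2 * ∑ i, σ i ^ 2 := by
  have h := variance_sum_pi (μ := fun _ : ι => gaussianReal 0 1)
    (X := fun i x => σ i / 2 * (x ^ 2 - 1))
    fun i => (memLp_sq_gaussianReal.sub (memLp_const _)).const_mul _
  have : (∑ i, fun x : ι → ℝ => σ i / 2 * (x i ^ 2 - 1)) =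
      fun x : ι → ℝ => ∑ i, σ i / 2 * (x i ^ 2 - 1) := by ext; simp
  rw [this] at h
  rw [h, Finset.mul_sum]
  refine Finset.sum_congr rfl fun i _ => ?_
  rw [variance_const_mul, variance_sub_const (by fun_prop), variance_sq_gaussianReal]
  ring

theorem charFun_map_weighted_chiSq (σ : ι → ℝ) (t : ℝ) :
    charFun ((Measure.pi fun _ => gaussianReal 0 1).map
      fun x : ι → ℝ => ∑ i, σ i / 2 * (x i ^ 2 - 1)) t = Complex.exp (chiSqLogCharFun σ t) := by
  rw [charFun_apply_real, integral_map (Measurable.aemeasurable (by fun_prop))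
    (Measurable.aestronglyMeasurable (by fun_prop)), chiSqLogCharFun,
    Complex.exp_sum]
  have h : ∀ x : ι → ℝ, Complex.exp (t * (∑ i, σ i / 2 * (x i ^ 2 - 1) : ℝ) * Complex.I) =
      ∏ i, Complex.exp ((σ i * t / 2 * (x i ^ 2 - 1) : ℝ) * Complex.I) := by
    intro x
    rw [← Complex.exp_sum, ← Finset.sum_mul, ← Complex.ofReal_sum, ← Complex.ofReal_mul,
      Finset.mul_sum]
    congr 3
    exact Finset.sum_congr rfl fun i _ => by ring
  simp_rw [h]
  rw [integral_fintype_prod_eq_prod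
    (f := fun i (x : ℝ) => Complex.exp ((σ i * t / 2 * (x ^ 2 - 1) : ℝ) * Complex.I))]
  refine Finset.prod_congr rfl fun i _ => ?_
  rw [integral_cexp_sq_sub_one_gaussianReal]
  push_cast
  rfl

variable [DecidableEq ι] {A : Matrix ι ι ℝ}

open Matrix

/-- The centered quadratic form `(xᵀ A x - tr A) / 2`. -/
noncomputable def centeredQuadForm (A : Matrix ι ι ℝ) (x : EuclideanSpace ℝ ι) : ℝ :=
  1 / 2 * (inner ℝ x (toEuclideanCLM (n := ι) (𝕜 := ℝ) A x) - A.trace)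

@[fun_prop]
theorem continuous_centeredQuadForm (A : Matrix ι ι ℝ) : Continuous (centeredQuadForm A) := by
  unfold centeredQuadForm
  fun_prop

theorem toEuclideanCLM_eigenvectorBasis (hA : A.IsHermitian) (i : ι) :
    toEuclideanCLM (n := ι) (𝕜 := ℝ) A (hA.eigenvectorBasis i) =
      hA.eigenvalues i • hA.eigenvectorBasis i := by
  ext j
  simpa using congrFun (hA.mulVec_eigenvectorBasis i) j

theorem centeredQuadForm_sum_eigenvectorBasis (hA : A.IsHermitian) (x : ι → ℝ) :
    centeredQuadForm A (∑ i, x i • hA.eigenvectorBasis i) =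
      ∑ i, hA.eigenvalues i / 2 * (x i ^ 2 - 1) := by
  have h1 : toEuclideanCLM (n := ι) (𝕜 := ℝ) A (∑ i, x i • hA.eigenvectorBasis i) =
      ∑ i, (x i * hA.eigenvalues i) • hA.eigenvectorBasis i := by
    simp only [map_sum, map_smul, toEuclideanCLM_eigenvectorBasis, smul_smul]
  rw [centeredQuadForm, h1, hA.eigenvectorBasis.orthonormal.inner_sum,
    hA.trace_eq_sum_eigenvalues, RCLike.ofReal_real_eq_id, ← Finset.sum_sub_distrib,
    Finset.mul_sum]
  refine Finset.sum_congr rfl fun i _ => ?_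
  simp; ring

/-- Rotation invariance: the coordinates in any orthonormal basis are independent standard normal.
-/
theorem stdGaussian_eq_map_eigenvectorBasis (hA : A.IsHermitian) :
    stdGaussian (EuclideanSpace ℝ ι) = (Measure.pi fun _ : ι => gaussianReal 0 1).map
      fun x => ∑ i, x i • hA.eigenvectorBasis i :=
  stdGaussian_eq_map_pi_orthonormalBasis hA.eigenvectorBasis

theorem memLp_centeredQuadForm (hA : A.IsHermitian) :
    MemLp (centeredQuadForm A) 2 (stdGaussian (EuclideanSpace ℝ ι)) := by
  rw [stdGaussian_eq_map_eigenvectorBasis hA, memLp_map_measure_iff (by fun_prop)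
    (Measurable.aemeasurable (by fun_prop))]
  refine (memLp_weighted_chiSq hA.eigenvalues).congr_norm
    (Measurable.aestronglyMeasurable ?_) (.of_forall fun x => ?_)
  · exact (continuous_centeredQuadForm A).measurable.comp (by fun_prop)
  · rw [Function.comp_apply, centeredQuadForm_sum_eigenvectorBasis]

theorem variance_centeredQuadForm (hA : A.IsHermitian) :
    Var[centeredQuadForm A; stdGaussian (EuclideanSpace ℝ ι)] =
      1 / 2 * ∑ i, hA.eigenvalues i ^ 2 := by
  rw [stdGaussian_eq_map_eigenvectorBasis hA, variance_map (by fun_prop)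
    (Measurable.aemeasurable (by fun_prop)), ← variance_weighted_chiSq]
  congr 1
  ext x
  rw [Function.comp_apply, centeredQuadForm_sum_eigenvectorBasis]

theorem charFun_map_centeredQuadForm (hA : A.IsHermitian) (t : ℝ) :
    charFun ((stdGaussian (EuclideanSpace ℝ ι)).map (centeredQuadForm A)) t =
      Complex.exp (chiSqLogCharFun hA.eigenvalues t) := by
  rw [stdGaussian_eq_map_eigenvectorBasis hA, Measure.map_map (by fun_prop) (by fun_prop),
    ← charFun_map_weighted_chiSq]
  congr 2
  ext x
  rw [Function.comp_apply, centeredQuadForm_sum_eigenvectorBasis]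

theorem trace_mul_self_eq_sum_eigenvalues_sq (hA : A.IsHermitian) :
    (A * A).trace = ∑ i, hA.eigenvalues i ^ 2 := by
  have h : A * A = Unitary.conjStarAlgAut ℝ _ hA.eigenvectorUnitary
      (diagonal hA.eigenvalues * diagonal hA.eigenvalues) := by
    rw [map_mul]
    exact congrArg₂ (· * ·) hA.spectral_theorem hA.spectral_theorem
  rw [h, Unitary.conjStarAlgAut_apply, trace_mul_comm, ← mul_assoc]
  simp [diagonal_mul_diagonal, trace_diagonal, sq]

theorem sum_sq_eq_sum_eigenvalues_sq (hA : A.IsHermitian) :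
    ∑ i, ∑ j, A i j ^ 2 = ∑ i, hA.eigenvalues i ^ 2 := by
  rw [← trace_mul_self_eq_sum_eigenvalues_sq hA]
  simp only [trace, diag, mul_apply]
  refine Finset.sum_congr rfl fun i _ => Finset.sum_congr rfl fun j _ => ?_
  have := hA.apply j i
  simp only [star_trivial] at this
  rw [this, sq]

theorem abs_eigenvalues_le_norm (hA : A.IsHermitian) (i : ι) :
    |hA.eigenvalues i| ≤ ‖toEuclideanCLM (n := ι) (𝕜 := ℝ) A‖ := by
  have h := (toEuclideanCLM (n := ι) (𝕜 := ℝ) A).le_opNorm (hA.eigenvectorBasis i)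
  rw [toEuclideanCLM_eigenvectorBasis, norm_smul, hA.eigenvectorBasis.orthonormal.1 i] at h
  simpa using h

end QuadraticForm

/-! ### Inverse square roots of positive definite matrices -/

namespace LMM

section InvSqrt

open Matrix
open scoped MatrixOrder

variable {k : ℕ} {P : Matrix (Fin k) (Fin k) ℝ}

theorem sqrt_mul_sqrt_of_posDef (hP : P.PosDef) : CFC.sqrt P * CFC.sqrt P = P :=
  CFC.sqrt_mul_sqrt_self P hP.posSemidef.nonneg

theorem isUnit_det_sqrt (hP : P.PosDef) : IsUnit (CFC.sqrt P).det := by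
  have h := congrArg det (sqrt_mul_sqrt_of_posDef hP)
  rw [det_mul] at h
  exact isUnit_iff_ne_zero.2 fun h0 => hP.det_pos.ne' (by rw [← h, h0, mul_zero])

theorem transpose_sqrt (P : Matrix (Fin k) (Fin k) ℝ) : (CFC.sqrt P)ᵀ = CFC.sqrt P := by
  have := (CFC.sqrt_nonneg P).isSelfAdjoint
  simpa [IsSelfAdjoint, star_eq_conjTranspose] using this

theorem transpose_invSqrt (P : Matrix (Fin k) (Fin k) ℝ) : (invSqrt P)ᵀ = invSqrt P := by
  rw [invSqrt, transpose_nonsing_inv, transpose_sqrt]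

theorem invSqrt_mul_invSqrt (hP : P.PosDef) : invSqrt P * invSqrt P = P⁻¹ := by
  rw [invSqrt, ← Matrix.mul_inv_rev, sqrt_mul_sqrt_of_posDef hP]

theorem invSqrt_mul_sqrt (hP : P.PosDef) : invSqrt P * CFC.sqrt P = 1 :=
  nonsing_inv_mul _ (isUnit_det_sqrt hP)

theorem sqrt_mul_invSqrt (hP : P.PosDef) : CFC.sqrt P * invSqrt P = 1 :=
  mul_nonsing_inv _ (isUnit_det_sqrt hP)

theorem sqrt_mul_inv (hP : P.PosDef) : CFC.sqrt P * P⁻¹ = invSqrt P := by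
  rw [← invSqrt_mul_invSqrt hP, ← mul_assoc, sqrt_mul_invSqrt hP, one_mul]

theorem inv_mul_sqrt (hP : P.PosDef) : P⁻¹ * CFC.sqrt P = invSqrt P := by
  rw [← invSqrt_mul_invSqrt hP, mul_assoc, invSqrt_mul_sqrt hP, mul_one]

theorem invSqrt_mul_self_mul_invSqrt (hP : P.PosDef) : invSqrt P * P * invSqrt P = 1 := by
  nth_rw 2 [← sqrt_mul_sqrt_of_posDef hP]
  rw [← mul_assoc, invSqrt_mul_sqrt hP, one_mul, sqrt_mul_invSqrt hP]

end InvSqrt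

end LMM

/-! ### Derivatives of the determinant and the inverse -/

section MatrixCalculus

open Matrix
attribute [local instance] Matrix.linftyOpNormedRing Matrix.linftyOpNormedAlgebra

variable {ι : Type*} [Fintype ι] [DecidableEq ι]

/-- After factoring out `P`, the determinant of `1 + s B'` is `1 + s tr B'` plus `s²` times a
polynomial in `s`. -/
theorem Matrix.hasDerivAt_det_add_smul {P : Matrix ι ι ℝ} (hP : IsUnit P.det) (B : Matrix ι ι ℝ) :
    HasDerivAt (fun s : ℝ => (P + s • B).det) (P.det * (P⁻¹ * B).trace) 0 := by
  have h : ∀ s : ℝ, (P + s • B).det = P.det * (1 + s • (P⁻¹ * B)).det := by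
    intro s
    rw [← det_mul, mul_add, mul_one, Matrix.mul_smul, ← mul_assoc, mul_nonsing_inv _ hP, one_mul]
  simp_rw [h]
  refine HasDerivAt.const_mul _ ?_
  simp only [funext fun s : ℝ => det_one_add_smul s (P⁻¹ * B)]
  have h1 := (((hasDerivAt_id (0 : ℝ)).const_mul (P⁻¹ * B).trace).const_add 1).add
    (((det (1 + (Polynomial.X : Polynomial ℝ) • (P⁻¹ * B).map Polynomial.C)).divX.divX.hasDerivAt
      0).mul ((hasDerivAt_id (0 : ℝ)).pow 2))
  refine h1.congr_deriv ?_
  simp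

theorem Matrix.differentiable_det : Differentiable ℝ fun M : Matrix ι ι ℝ => M.det := by
  simp_rw [det_apply]
  have h : ∀ i j, Differentiable ℝ fun M : Matrix ι ι ℝ => M i j := fun i j =>
    (LinearMap.toContinuousLinearMap (entryLinearMap ℝ ℝ i j)).differentiable
  fun_prop

theorem Matrix.hasFDerivAt_inv {P : Matrix ι ι ℝ} (hP : IsUnit P.det) :
    HasFDerivAt (fun M : Matrix ι ι ℝ => M⁻¹)
      (-ContinuousLinearMap.mulLeftRight ℝ (Matrix ι ι ℝ) P⁻¹ P⁻¹) P := by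
  obtain ⟨u, rfl⟩ := (isUnit_iff_isUnit_det P).2 hP
  have h := hasFDerivAt_ringInverse (𝕜 := ℝ) u
  simp_rw [nonsing_inv_eq_ringInverse, Ring.inverse_unit]
  convert h using 1

end MatrixCalculus

/-! ### The score as a quadratic form, and the Fisher information -/

namespace LMM.Model

open Matrix
attribute [local instance] Matrix.linftyOpNormedRing Matrix.linftyOpNormedAlgebra

variable {n q m : ℕ} (M : Model n q m)

theorem Sigma_add_smul (v u : EuclideanSpace ℝ (Fin (m + 1))) (s : ℝ) :
    M.Sigma (v + s • u) = M.Sigma v + s • M.Sigma u := by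
  simp [Sigma_eq_sum, add_smul, Finset.sum_add_distrib, Finset.smul_sum, smul_smul]

theorem differentiable_Sigma : Differentiable ℝ M.Sigma := by
  have : M.Sigma = fun v => ∑ j, v j • M.dSigma j := funext M.Sigma_eq_sum
  rw [this]
  fun_prop

theorem transpose_dSigma (j : Fin (m + 1)) : (M.dSigma j)ᵀ = M.dSigma j := by
  refine Fin.lastCases ?_ (fun j => ?_) j
  · simp [dSigma]
  · have : (M.H j)ᵀ = M.H j := by
      ext i k
      simp [H, M.pattern.symm k i]
    simp [dSigma, this, Matrix.mul_assoc]

theorem posDef_Sigma {ψ : EuclideanSpace ℝ (Fin (m + 1))} (hψ : ψ ∈ M.paramSet) :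
    (M.Sigma ψ).PosDef := by
  have h1 : (M.Z * M.Psi ψ * M.Zᵀ).PosSemidef := by
    simpa using hψ.1.mul_mul_conjTranspose_same M.Z
  exact Matrix.PosDef.posSemidef_add h1 (Matrix.PosDef.one.smul hψ.2)

/-- Full differentiability is needed so that the gradient, which defaults to zero otherwise,
determines the directional derivatives. -/
theorem differentiableAt_logLik {ψ : EuclideanSpace ℝ (Fin (m + 1))} (hψ : (M.Sigma ψ).PosDef)
    (y : EuclideanSpace ℝ (Fin n)) : DifferentiableAt ℝ (M.logLik y) ψ := by
  have hS := M.differentiable_Sigma ψ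
  have hdet : DifferentiableAt ℝ (fun v => (M.Sigma v).det) ψ :=
    (differentiable_det _).comp ψ hS
  have hinv : DifferentiableAt ℝ (fun v => (M.Sigma v)⁻¹) ψ :=
    (hasFDerivAt_inv hψ.det_pos.ne'.isUnit).differentiableAt.comp ψ hS
  have hquad : DifferentiableAt ℝ (fun v => y.ofLp ⬝ᵥ ((M.Sigma v)⁻¹ *ᵥ y.ofLp)) ψ := by
    let Q : Matrix (Fin n) (Fin n) ℝ →ₗ[ℝ] ℝ :=
      { toFun := fun B => y.ofLp ⬝ᵥ (B *ᵥ y.ofLp)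
        map_add' := fun B C => by rw [add_mulVec, dotProduct_add]
        map_smul' := fun c B => by rw [smul_mulVec, dotProduct_smul]; rfl }
    exact (LinearMap.toContinuousLinearMap Q).differentiableAt.comp ψ hinv
  exact ((hdet.log hψ.det_pos.ne').add hquad).const_mul _

/-- The derivative along `ψ + s u`, where `Σ` is affine in `s`, suffices: the determinant
contributes the trace and the inverse contributes `-Σ⁻¹ Σ(u) Σ⁻¹`. -/
theorem inner_score {ψ : EuclideanSpace ℝ (Fin (m + 1))} (hψ : (M.Sigma ψ).PosDef)
    (u : EuclideanSpace ℝ (Fin (m + 1))) (y : EuclideanSpace ℝ (Fin n)) :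
    inner ℝ u (M.score ψ y) = 1 / 2 *
      (y.ofLp ⬝ᵥ (((M.Sigma ψ)⁻¹ * M.Sigma u * (M.Sigma ψ)⁻¹) *ᵥ y.ofLp) -
        ((M.Sigma ψ)⁻¹ * M.Sigma u).trace) := by
  have hu : IsUnit (M.Sigma ψ).det := hψ.det_pos.ne'.isUnit
  have hgrad : inner ℝ u (M.score ψ y) = fderiv ℝ (M.logLik y) ψ u := by
    rw [real_inner_comm, score, ← toDual_gradient, InnerProductSpace.toDual_apply_apply]
  have hline : HasDerivAt (fun s : ℝ => M.logLik y (ψ + s • u)) (fderiv ℝ (M.logLik y) ψ u) 0 :=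
    (M.differentiableAt_logLik hψ y).hasFDerivAt.hasLineDerivAt u
  have hdet := (hasDerivAt_det_add_smul hu (M.Sigma u)).log
    (by simpa using hψ.det_pos.ne')
  have hlin : HasDerivAt (fun s : ℝ => M.Sigma ψ + s • M.Sigma u) (M.Sigma u) 0 := by
    exact (((hasDerivAt_id (0 : ℝ)).smul_const (M.Sigma u)).const_add (M.Sigma ψ)).congr_deriv
      (one_smul ℝ _)
  have hinv : HasDerivAt (fun s : ℝ => (M.Sigma ψ + s • M.Sigma u)⁻¹)
      (-((M.Sigma ψ)⁻¹ * M.Sigma u * (M.Sigma ψ)⁻¹)) 0 := by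
    have h0 : M.Sigma ψ + (0 : ℝ) • M.Sigma u = M.Sigma ψ := by simp
    have h := (hasFDerivAt_inv (P := M.Sigma ψ + (0 : ℝ) • M.Sigma u)
      (by rwa [h0])).comp_hasDerivAt (0 : ℝ) hlin
    simp only [h0] at h
    exact h
  let Q : Matrix (Fin n) (Fin n) ℝ →ₗ[ℝ] ℝ :=
      { toFun := fun B => y.ofLp ⬝ᵥ (B *ᵥ y.ofLp)
        map_add' := fun B C => by rw [add_mulVec, dotProduct_add]
        map_smul' := fun c B => by rw [smul_mulVec, dotProduct_smul]; rfl }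
  have hquad : HasDerivAt (fun s : ℝ => y.ofLp ⬝ᵥ ((M.Sigma ψ + s • M.Sigma u)⁻¹ *ᵥ y.ofLp))
      (y.ofLp ⬝ᵥ ((-((M.Sigma ψ)⁻¹ * M.Sigma u * (M.Sigma ψ)⁻¹)) *ᵥ y.ofLp)) 0 :=
    (LinearMap.toContinuousLinearMap Q).hasFDerivAt.comp_hasDerivAt (0 : ℝ) hinv
  have hline' := (hdet.add hquad).const_mul (-(1 / 2) : ℝ)
  have heq : (fun s : ℝ => M.logLik y (ψ + s • u)) = fun s : ℝ => -(1 / 2) *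
      (Real.log (M.Sigma ψ + s • M.Sigma u).det +
        y.ofLp ⬝ᵥ ((M.Sigma ψ + s • M.Sigma u)⁻¹ *ᵥ y.ofLp)) := by
    ext s
    rw [logLik, Sigma_add_smul]
  rw [heq] at hline
  rw [hgrad, hline.unique hline']
  have hne := hψ.det_pos.ne'
  simp only [zero_smul, add_zero, neg_mulVec, dotProduct_neg, mul_div_cancel_left₀ _ hne]
  ring

theorem isHermitian_A (u ψ : EuclideanSpace ℝ (Fin (m + 1))) : (M.A u ψ).IsHermitian := by
  have h : (M.Sigma u)ᵀ = M.Sigma u := by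
    simp [Sigma_eq_sum, transpose_sum, transpose_dSigma]
  simp [Matrix.IsHermitian, A_eq, transpose_mul, transpose_invSqrt, h, mul_assoc]

theorem A_smul (c : ℝ) (u ψ : EuclideanSpace ℝ (Fin (m + 1))) :
    M.A (c • u) ψ = c • M.A u ψ := by
  simp [A, Finset.smul_sum, smul_smul]

open scoped MatrixOrder in
/-- In terms of the standardized observations, linear combinations of the scores are centered
quadratic forms. -/
theorem inner_score_sqrt {ψ : EuclideanSpace ℝ (Fin (m + 1))} (hψ : (M.Sigma ψ).PosDef)
    (u : EuclideanSpace ℝ (Fin (m + 1))) (x : EuclideanSpace ℝ (Fin n)) :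
    inner ℝ u (M.score ψ (toEuclideanCLM (n := Fin n) (𝕜 := ℝ) (CFC.sqrt (M.Sigma ψ)) x)) =
      centeredQuadForm (M.A u ψ) x := by
  rw [inner_score M hψ, centeredQuadForm, A_eq, inner_toEuclideanCLM, ofLp_toEuclideanCLM,
    mulVec_mulVec, ← vecMul_transpose, ← dotProduct_mulVec, mulVec_mulVec, transpose_sqrt]
  congr 2
  · congr 2
    simp only [← mul_assoc, sqrt_mul_inv hψ]
    rw [mul_assoc _ _ (CFC.sqrt _), inv_mul_sqrt hψ]
  · rw [trace_mul_comm (invSqrt _ * _), ← mul_assoc, invSqrt_mul_invSqrt hψ]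

open scoped MatrixOrder in
theorem law_eq_map (ψ : EuclideanSpace ℝ (Fin (m + 1))) :
    M.law ψ = (stdGaussian (EuclideanSpace ℝ (Fin n))).map
      (toEuclideanCLM (n := Fin n) (𝕜 := ℝ) (CFC.sqrt (M.Sigma ψ))) := by
  simp [law, multivariateGaussian]

theorem measurable_inner_score {ψ : EuclideanSpace ℝ (Fin (m + 1))} (hψ : (M.Sigma ψ).PosDef)
    (u : EuclideanSpace ℝ (Fin (m + 1))) : Measurable fun y => inner ℝ u (M.score ψ y) := by
  simp_rw [M.inner_score hψ]
  refine Continuous.measurable ?_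
  simp_rw [← inner_toEuclideanCLM]
  fun_prop

theorem map_inner_score {ψ : EuclideanSpace ℝ (Fin (m + 1))} (hψ : (M.Sigma ψ).PosDef)
    (u : EuclideanSpace ℝ (Fin (m + 1))) :
    (M.law ψ).map (fun y => inner ℝ u (M.score ψ y)) =
      (stdGaussian (EuclideanSpace ℝ (Fin n))).map (centeredQuadForm (M.A u ψ)) := by
  rw [law_eq_map, Measure.map_map (M.measurable_inner_score hψ u) (by fun_prop)]
  congr 1
  ext x
  exact M.inner_score_sqrt hψ u x

theorem memLp_inner_score {ψ : EuclideanSpace ℝ (Fin (m + 1))} (hψ : (M.Sigma ψ).PosDef)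
    (u : EuclideanSpace ℝ (Fin (m + 1))) :
    MemLp (fun y => inner ℝ u (M.score ψ y)) 2 (M.law ψ) := by
  rw [law_eq_map, memLp_map_measure_iff (M.measurable_inner_score hψ u).aestronglyMeasurable
    (by fun_prop)]
  exact (memLp_centeredQuadForm (M.isHermitian_A u ψ)).congr_norm
    ((M.measurable_inner_score hψ u).comp (by fun_prop)).aestronglyMeasurable
    (.of_forall fun x => by rw [Function.comp_apply, M.inner_score_sqrt hψ])

theorem variance_inner_score {ψ : EuclideanSpace ℝ (Fin (m + 1))} (hψ : (M.Sigma ψ).PosDef)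
    (u : EuclideanSpace ℝ (Fin (m + 1))) :
    Var[fun y => inner ℝ u (M.score ψ y); M.law ψ] = 1 / 2 * frobNorm (M.A u ψ) ^ 2 := by
  rw [frobNorm, Real.sq_sqrt (by positivity), sum_sq_eq_sum_eigenvalues_sq (M.isHermitian_A u ψ),
    ← variance_centeredQuadForm, law_eq_map,
    variance_map (M.measurable_inner_score hψ u).aemeasurable (by fun_prop)]
  congr 1
  ext x
  exact M.inner_score_sqrt hψ u x

/-- Both sides are the variance of `uᵀS`, the left one by bilinearity of the covariance. -/
theorem dotProduct_fisherInfo {ψ : EuclideanSpace ℝ (Fin (m + 1))} (hψ : (M.Sigma ψ).PosDef)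
    (u : EuclideanSpace ℝ (Fin (m + 1))) :
    u.ofLp ⬝ᵥ (M.fisherInfo ψ *ᵥ u.ofLp) = 1 / 2 * frobNorm (M.A u ψ) ^ 2 := by
  have hmem : ∀ i, MemLp (fun y => u i * M.score ψ y i) 2 (M.law ψ) := fun i => by
    simpa [EuclideanSpace.inner_single_left] using
      (M.memLp_inner_score hψ (EuclideanSpace.single i 1)).const_mul (u i)
  have hprob : IsProbabilityMeasure (M.law ψ) := by
    rw [law]; infer_instance
  have hsum : (fun y => inner ℝ u (M.score ψ y)) = fun y => ∑ i, u i * M.score ψ y i := by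
    ext y; simp [PiLp.inner_apply, mul_comm]
  rw [← M.variance_inner_score hψ, hsum, variance_fun_sum hmem]
  simp only [dotProduct, mulVec, Finset.mul_sum]
  refine Finset.sum_congr rfl fun i _ => Finset.sum_congr rfl fun j _ => ?_
  rw [covariance_const_mul_left, covariance_const_mul_right]
  simp only [fisherInfo, of_apply]
  ring

end LMM.Model

/-! ### Comparison with the normal density -/

section GaussianComparison

open Complex

theorem charFun_gaussianReal_zero_one (t : ℝ) :
    charFun (gaussianReal 0 1) t = exp (-t ^ 2 / 2) := by
  rw [charFun_gaussianReal]
  congr 1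
  simp
  ring

theorem integrable_charFun_gaussianReal_zero_one : Integrable (charFun (gaussianReal 0 1)) := by
  have h := integrable_cexp_neg_mul_sq (b := (1 / 2 : ℂ)) (by norm_num)
  refine h.congr (.of_forall fun t => ?_)
  simp only [charFun_gaussianReal_zero_one]
  congr 1
  ring

theorem isContinuousDensity_gaussianPDFReal :
    LMM.IsContinuousDensity (gaussianReal 0 1) (gaussianPDFReal 0 1) := by
  refine ⟨?_, gaussianPDFReal_nonneg 0 1, gaussianReal_of_var_ne_zero 0 one_ne_zero⟩
  rw [gaussianPDFReal_def]
  fun_prop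

theorem density_bound_le {a : ℝ} (ha : 0 < a) (ha2 : a ^ 2 < 1 / 8) :
    (2 * Real.pi)⁻¹ * (2 * (Real.sqrt 2 * a / (1 - 2 * (Real.sqrt 2 * a) ^ 2))) ≤
      0.14 * (4 + 0.29 * ((1 - 8 * a ^ 2) ^ 2)⁻¹) * a := by
  have hs2 : Real.sqrt 2 < 1.41422 := by
    rw [Real.sqrt_lt' (by norm_num)]; norm_num
  have hc : Real.sqrt 2 / Real.pi ≤ 0.4502 := by
    rw [div_le_iff₀ Real.pi_pos]
    nlinarith [Real.pi_gt_d6]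
  set w : ℝ := 1 - 8 * a ^ 2 with hw
  have hw0 : 0 < w := by linarith
  -- With `b = √2 a`, this is `1 - 4a² = (1 + w) / 2`, so the claim becomes a one-variable
  -- inequality for `w > 0`.
  have hw1 : 1 - 2 * (Real.sqrt 2 * a) ^ 2 = (1 + w) / 2 := by
    rw [mul_pow, Real.sq_sqrt (by norm_num)]; linarith
  rw [hw1]
  have h1 : (2 * Real.pi)⁻¹ * (2 * (Real.sqrt 2 * a / ((1 + w) / 2))) =
      Real.sqrt 2 / Real.pi * (2 / (1 + w)) * a := by
    field_simp
  rw [h1]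
  refine mul_le_mul_of_nonneg_right ?_ ha.le
  refine (mul_le_mul_of_nonneg_right hc (by positivity)).trans ?_
  rw [← sub_nonneg]
  have : 0.14 * (4 + 0.29 * (w ^ 2)⁻¹) - 0.4502 * (2 / (1 + w)) =
      (0.56 * w ^ 3 - 0.3404 * w ^ 2 + 0.0406 * w + 0.0406) / (w ^ 2 * (1 + w)) := by
    field_simp; ring
  rw [this]
  refine div_nonneg ?_ (by positivity)
  -- The cubic has its local minimum near `0.33`. Subtracting `0.56 w (w - 0.36)²` leaves a
  -- quadratic with negative discriminant.
  nlinarith [mul_nonneg hw0.le (sq_nonneg (w - 0.36)), sq_nonneg (w - 0.36)]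

/-- Normal approximation of the density of a standardized Gaussian quadratic form whose matrix has
small spectral norm. -/
theorem exists_density_near_gaussian {ι : Type*} [Fintype ι] {σ : ι → ℝ} {a : ℝ} (ha : 0 < a)
    (ha2 : a ^ 2 < 1 / 8) (hσ : ∑ i, σ i ^ 2 = 2) (hσa : ∀ i, |σ i| ≤ Real.sqrt 2 * a)
    {μ : Measure ℝ} [IsProbabilityMeasure μ]
    (hμ : ∀ t, charFun μ t = exp (chiSqLogCharFun σ t)) :
    ∃ g : ℝ → ℝ, LMM.IsContinuousDensity μ g ∧ ∀ t : ℝ, |g t - gaussianPDFReal 0 1 t| ≤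
      0.14 * (4 + 0.29 * ((1 - 8 * a ^ 2) ^ 2)⁻¹) * a := by
  have hb : 0 < Real.sqrt 2 * a := by positivity
  have hb2 : (Real.sqrt 2 * a) ^ 2 < 1 / 4 := by
    rw [mul_pow, Real.sq_sqrt (by norm_num)]; linarith
  have hint : Integrable (charFun μ) := by
    rw [funext hμ]
    exact integrable_exp_chiSqLogCharFun hb hb2 hσ hσa
  refine ⟨_, isContinuousDensity_invCharFun hint, fun t => ?_⟩
  rw [← invCharFun_re_eq_of_isContinuousDensity integrable_charFun_gaussianReal_zero_one
    isContinuousDensity_gaussianPDFReal]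
  refine (abs_re_invCharFun_sub_le hint integrable_charFun_gaussianReal_zero_one t).trans
    (le_trans ?_ (density_bound_le ha ha2))
  simp only [hμ, charFun_gaussianReal_zero_one]
  exact mul_le_mul_of_nonneg_left (integral_norm_exp_chiSqLogCharFun_sub_le hb hb2 hσ hσa)
    (by positivity)

end GaussianComparison

/-! ### Scale invariance of `a` and standardization of the score -/

namespace LMM

open Matrix

section Norms

variable {k : ℕ}

theorem frobNorm_nonneg (B : Matrix (Fin k) (Fin k) ℝ) : 0 ≤ frobNorm B := Real.sqrt_nonneg _

theorem frobNorm_smul (c : ℝ) (B : Matrix (Fin k) (Fin k) ℝ) :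
    frobNorm (c • B) = |c| * frobNorm B := by
  simp only [frobNorm, Matrix.smul_apply, smul_eq_mul, mul_pow, ← Finset.mul_sum]
  rw [Real.sqrt_mul (sq_nonneg c), Real.sqrt_sq_eq_abs]

theorem specNorm_smul (c : ℝ) (B : Matrix (Fin k) (Fin k) ℝ) :
    specNorm (c • B) = |c| * specNorm B := by
  rw [specNorm, map_smul, norm_smul, Real.norm_eq_abs, specNorm]

end Norms

namespace Model

variable {n q m : ℕ} (M : Model n q m) {ψ : EuclideanSpace ℝ (Fin (m + 1))} {abar : ℝ}

/-- Both norms are homogeneous, so the bound on unit vectors extends to all `u ≠ 0`. The convention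
`a = 1` for `A = 0` is what excludes a vanishing matrix. -/
theorem frobNorm_A_pos_and_specNorm_A_le (habar : abar < 1)
    (ha : ∀ v : EuclideanSpace ℝ (Fin (m + 1)), ‖v‖ = 1 → M.a v ψ ≤ abar)
    {u : EuclideanSpace ℝ (Fin (m + 1))} (hu : u ≠ 0) :
    0 < frobNorm (M.A u ψ) ∧ specNorm (M.A u ψ) ≤ abar * frobNorm (M.A u ψ) := by
  have hu0 : 0 < ‖u‖ := norm_pos_iff.2 hu
  set v : EuclideanSpace ℝ (Fin (m + 1)) := ‖u‖⁻¹ • u with hv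
  have hv1 : ‖v‖ = 1 := by
    rw [hv, norm_smul, norm_inv, norm_norm, inv_mul_cancel₀ hu0.ne']
  have hav := ha v hv1
  have hne : frobNorm (M.A v ψ) ≠ 0 := fun h => by
    rw [a, if_pos h] at hav
    linarith
  have hpos : 0 < frobNorm (M.A v ψ) := (frobNorm_nonneg _).lt_of_ne' hne
  rw [a, if_neg hne, div_le_iff₀ hpos] at hav
  have huv : M.A u ψ = ‖u‖ • M.A v ψ := by
    rw [← A_smul, hv, smul_inv_smul₀ hu0.ne']
  rw [huv, frobNorm_smul, specNorm_smul, abs_of_pos hu0]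
  refine ⟨by positivity, ?_⟩
  nlinarith

theorem posDef_fisherInfo (hψ : (M.Sigma ψ).PosDef)
    (hA : ∀ u : EuclideanSpace ℝ (Fin (m + 1)), u ≠ 0 → 0 < frobNorm (M.A u ψ)) :
    (M.fisherInfo ψ).PosDef := by
  refine Matrix.PosDef.of_dotProduct_mulVec_pos ?_ fun x hx => ?_
  · ext i j
    simp only [conjTranspose_apply, star_trivial, fisherInfo, of_apply]
    exact covariance_comm _ _
  · have h := M.dotProduct_fisherInfo hψ (WithLp.toLp 2 x)
    have hpos := hA (WithLp.toLp 2 x) (by simpa using hx)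
    simp only [star_trivial]
    rw [h]
    positivity

theorem inner_W (ψ v : EuclideanSpace ℝ (Fin (m + 1))) (y : EuclideanSpace ℝ (Fin n)) :
    inner ℝ v (M.W ψ y) = inner ℝ (toEuclideanCLM (n := Fin (m + 1)) (𝕜 := ℝ)
      (invSqrt (M.fisherInfo ψ)) v) (M.score ψ y) := by
  rw [W, inner_toEuclideanCLM, real_inner_comm, inner_toEuclideanCLM, dotProduct_mulVec,
    ← mulVec_transpose, transpose_invSqrt, dotProduct_comm]

/-- For `u = I^{-1/2} v` one has `uᵀ I u = vᵀv = 1`, and the left side is half the squared Frobenius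
norm. -/
theorem frobNorm_A_invSqrt_fisherInfo (hψ : (M.Sigma ψ).PosDef) (hI : (M.fisherInfo ψ).PosDef)
    {v : EuclideanSpace ℝ (Fin (m + 1))} (hv : ‖v‖ = 1) :
    frobNorm (M.A (toEuclideanCLM (n := Fin (m + 1)) (𝕜 := ℝ)
      (invSqrt (M.fisherInfo ψ)) v) ψ) ^ 2 = 2 := by
  have h := M.dotProduct_fisherInfo hψ (toEuclideanCLM (n := Fin (m + 1)) (𝕜 := ℝ)
      (invSqrt (M.fisherInfo ψ)) v)
  rw [ofLp_toEuclideanCLM, mulVec_mulVec, ← vecMul_transpose, ← dotProduct_mulVec, mulVec_mulVec,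
    transpose_invSqrt, ← mul_assoc, invSqrt_mul_self_mul_invSqrt hI, one_mulVec] at h
  have hn : v.ofLp ⬝ᵥ v.ofLp = 1 := by
    have h2 := EuclideanSpace.real_norm_sq_eq v
    rw [hv] at h2
    simp only [dotProduct, ← sq]
    linarith
  linarith

end Model

end LMM

/-! ### The normal approximation of the standardized score -/

theorem lemma5 {n q m : ℕ} (M : LMM.Model n q m)
    (ψ : EuclideanSpace ℝ (Fin (m + 1))) (hψ : ψ ∈ M.paramSet)
    (abar : ℝ) (habar : abar ^ 2 < 1 / 8)
    (ha : ∀ v : EuclideanSpace ℝ (Fin (m + 1)), ‖v‖ = 1 → M.a v ψ ≤ abar) :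
    (M.fisherInfo ψ).PosDef ∧
    ∀ v : EuclideanSpace ℝ (Fin (m + 1)), ‖v‖ = 1 →
      ∃ g : ℝ → ℝ,
        LMM.IsContinuousDensity ((M.law ψ).map fun y => inner ℝ v (M.W ψ y)) g ∧
        ∀ t : ℝ, |g t - gaussianPDFReal 0 1 t| ≤
          0.14 * (4 + 0.29 * ((1 - 8 * abar ^ 2) ^ 2)⁻¹) * abar := by
  have hS := M.posDef_Sigma hψ
  have hA := fun u (hu : u ≠ 0) =>
    M.frobNorm_A_pos_and_specNorm_A_le (u := u) (by nlinarith) ha hu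
  have hI := M.posDef_fisherInfo hS fun u hu => (hA u hu).1
  refine ⟨hI, fun v hv => ?_⟩
  set u := Matrix.toEuclideanCLM (n := Fin (m + 1)) (𝕜 := ℝ)
    (LMM.invSqrt (M.fisherInfo ψ)) v with hu
  have hfrob : LMM.frobNorm (M.A u ψ) ^ 2 = 2 := M.frobNorm_A_invSqrt_fisherInfo hS hI hv
  have hu0 : u ≠ 0 := fun h => by
    rw [h, ← zero_smul ℝ (0 : EuclideanSpace ℝ (Fin (m + 1))), M.A_smul, LMM.frobNorm_smul] at hfrob
    norm_num at hfrob
  obtain ⟨hpos, hspec⟩ := hA u hu0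
  have hfrob' : LMM.frobNorm (M.A u ψ) = Real.sqrt 2 := by
    rw [← hfrob, Real.sqrt_sq hpos.le]
  have hherm := M.isHermitian_A u ψ
  have hσ : ∑ i, hherm.eigenvalues i ^ 2 = 2 := by
    rw [← sum_sq_eq_sum_eigenvalues_sq hherm, ← hfrob, LMM.frobNorm,
      Real.sq_sqrt (by positivity)]
  have hσa : ∀ i, |hherm.eigenvalues i| ≤ Real.sqrt 2 * abar := fun i => by
    have h := (abs_eigenvalues_le_norm hherm i).trans hspec
    rwa [hfrob', mul_comm] at h
  -- The sign of `abar` is not assumed: if it were nonpositive, all eigenvalues would vanish, while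
  -- their squares sum to 2.
  have habar0 : 0 < abar := by
    by_contra! h
    have hz : ∀ i, hherm.eigenvalues i = 0 := fun i => abs_nonpos_iff.1
      ((hσa i).trans (mul_nonpos_of_nonneg_of_nonpos (Real.sqrt_nonneg 2) h))
    simp [hz] at hσ
  have hmap : ((M.law ψ).map fun y => inner ℝ v (M.W ψ y)) =
      (stdGaussian (EuclideanSpace ℝ (Fin n))).map (centeredQuadForm (M.A u ψ)) := by
    rw [← M.map_inner_score hS u]
    simp_rw [M.inner_W, hu]
  rw [hmap]
  have : IsProbabilityMeasure
      ((stdGaussian (EuclideanSpace ℝ (Fin n))).map (centeredQuadForm (M.A u ψ))) :=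
    Measure.isProbabilityMeasure_map (by fun_prop)
  exact exists_density_near_gaussian habar0 habar hσ hσa (charFun_map_centeredQuadForm hherm)
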